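/- Let $n\ge 1$ and let $c=(c_1,\dots,c_{n-1})$ be a sequence of nonnegative integers with $c_1+\cdots+c_{n-1}=n-1$. Put $$y_c = x_1^{c_1}(x_1+x_2)^{c_2}\cdots(x_1+\cdots+x_{n-1})^{c_{n-1}}\in\mathbb{Q}[x_1,\dots,x_n].$$ Let $\mathrm{QSym}_n^+$ be the ideal of $\mathbb{Q}[x_1,\dots,x_n]$ generated by the quasisymmetric polynomials without constant term, and let $\mathrm{ABB}_n$ be the set of exponent vectors $(d_1,\dots,d_n)\in\mathbb{Z}_{\ge0}^n$ with $\sum_{1\le i\le j} d_{n+1-i}\le j-1$ for all $j=1,\dots,n$. Let the multivariate mixed Eulerian number $A_c(x_1,\dots,x_{n-1})$ be the reduction of $y_c$ modulo $\mathrm{QSym}_n^+$, that is, the representative of $y_c$ modulo $\mathrm{QSym}_n^+$ lying in the span of the monomials $x^d$, $d\in \mathrm{ABB}_n$ (these do not involve $x_n$); this representative exists and is unique. Consider letters $i^{(j)}$ with $i\in\mathbb{Z}$, $j\in\mathbb{Z}_{\ge1}$, ordered lexicographically by $(i,j)$, with $\mathrm{val}(i^{(j)})=i$. For a word $W=W_1\cdots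 W_k$ with pairwise distinct letters, define a finite set $\Omega(W)\subset\mathbb{Z}$ recursively: $\Omega$ of the empty word is empty, and for $W=W'a$: - if $\mathrm{val}(a)\notin\Omega(W')$, then $\Omega(W)=\Omega(W')\sqcup\{\mathrm{val}(a)\}$; - otherwise let $I$ be the maximal interval of consecutive integers in $\Omega(W')$ that contains $\mathrm{val}(a)$, and let $b=W_i$ with $i\le|W'|$ maximal such that $\mathrm{val}(W_i)\in I$; then $\Omega(W)=\Omega(W')\sqcup\{\min I-1\}$ if $a<b$, and $\Omega(W)=\Omega(W')\sqcup\{\max I+1\}$ if $a>b$. The word $W$ is an $\Omega$-parking word if $\Omega(W)=\{1,\dots,|W|\}$. Let $\mathbb{Z}_c=\{i^{(j)} : 1\le i\le n-1,\ 1\le j\le c_i\}$. There are $(n-1)!$ words of length $n-1$ with pairwise distinct letters in $\mathbb{Z}_c$, and the number of those that are $\Omega$-parking words equals the mixed Eulerian number $A_c(1^{n-1})=A_c(1,\dots,1)$. -/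

import Mathlib

open MvPolynomial

namespace OmegaParking

/-! ### Reduction modulo positive degree quasisymmetric polynomials

The variables `x_1, …, x_n` are `X 0, …, X (n-1)`, indexed by `Fin n`. -/

/-- `f ∈ ℚ[x_1, …, x_n]` is quasisymmetric: for every strong composition `α` with `k` parts, the
coefficients of `x_{i_1}^{α_1} ⋯ x_{i_k}^{α_k}` and `x_{j_1}^{α_1} ⋯ x_{j_k}^{α_k}` agree whenever
`i_1 < ⋯ < i_k` and `j_1 < ⋯ < j_k`. -/
def IsQuasisymmetric {n : ℕ} (f : MvPolynomial (Fin n) ℚ) : Prop :=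
  ∀ (k : ℕ) (α : Fin k → ℕ) (i j : Fin k → Fin n), (∀ t, 0 < α t) → StrictMono i → StrictMono j →
    coeff (∑ t, Finsupp.single (i t) (α t)) f = coeff (∑ t, Finsupp.single (j t) (α t)) f

/-- The ideal `QSym_n^+` of `ℚ[x_1, …, x_n]`, generated by the quasisymmetric polynomials that have
only terms of positive degree. -/
noncomputable def qsymIdeal (n : ℕ) : Ideal (MvPolynomial (Fin n) ℚ) :=
  Ideal.span {f | IsQuasisymmetric f ∧ constantCoeff f = 0}

/-- The set `ABB_n` of exponent vectors `(d_1, …, d_n)` such that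
`d_n + d_{n-1} + ⋯ + d_{n+1-j} ≤ j - 1` for `j = 1, …, n` (all indices are shifted by one). -/
def abbVectors (n : ℕ) : Set (Fin n →₀ ℕ) :=
  {d | ∀ j : Fin n, ∑ i ∈ Finset.Iic j, d (Fin.rev i) ≤ (j : ℕ)}

/-- The `ℚ`-span of the ABB monomials `x^d`, `d ∈ ABB_n`. -/
noncomputable def abbSpan (n : ℕ) : Submodule ℚ (MvPolynomial (Fin n) ℚ) :=
  Submodule.span ℚ ((fun d => monomial d (1 : ℚ)) '' abbVectors n)

/-- `r` is a representative of `f` modulo `QSym_n^+` in the span of the ABB monomials. -/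
def IsABBReduction {n : ℕ} (f r : MvPolynomial (Fin n) ℚ) : Prop :=
  r ∈ abbSpan n ∧ f - r ∈ qsymIdeal n

open Classical in
/-- `f mod QSym_n^+`, the representative of `f` in the span of the ABB monomials. -/
noncomputable def abbReduction {n : ℕ} (f : MvPolynomial (Fin n) ℚ) : MvPolynomial (Fin n) ℚ :=
  if h : ∃ r, IsABBReduction f r then h.choose else 0

/-! ### Multivariate mixed Eulerian numbers

Below `n = m + 1`, and `c = (c_1, …, c_{n-1})` is given by `c : Fin m → ℕ`. -/

/-- `y_c = x_1^{c_1} (x_1 + x_2)^{c_2} ⋯ (x_1 + ⋯ + x_{n-1})^{c_{n-1}}`, in `ℚ[x_1, …, x_n]`. -/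
noncomputable def yPoly {m : ℕ} (c : Fin m → ℕ) : MvPolynomial (Fin (m + 1)) ℚ :=
  ∏ i : Fin m, (∑ j ∈ Finset.Iic i, X j.castSucc) ^ c i

/-- The multivariate mixed Eulerian number `A_c(x_1, …, x_{n-1}) = y_c mod QSym_n^+`. It lives in
`ℚ[x_1, …, x_n]`, but an ABB vector has last entry `0`, so that `x_n` does not occur in it. -/
noncomputable def mixedEulerian {m : ℕ} (c : Fin m → ℕ) : MvPolynomial (Fin (m + 1)) ℚ :=
  abbReduction (yPoly c)

/-! ### The parking procedure -/

/-- The ordered alphabet of letters `i^(j)`, with `i ∈ ℤ` and `j ≥ 1`, in lexicographic order: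
`i^(1) < i^(2) < ⋯ < (i+1)^(1) < ⋯`. -/
abbrev Letter : Type := ℤ ×ₗ ℕ+

/-- The value `i` of the letter `i^(j)`: the spot that the car prefers. -/
def Letter.val (a : Letter) : ℤ := (ofLex a).1

/-- The superscript `j` of the letter `i^(j)`. -/
def Letter.sup (a : Letter) : ℕ+ := (ofLex a).2

/-- For `x ∈ S`, the maximal interval of consecutive integers that contains `x` and lies in `S`. -/
def block (S : Finset ℤ) (x : ℤ) : Finset ℤ :=
  S.filter fun y => Finset.uIcc x y ⊆ S

theorem block_nonempty {S : Finset ℤ} {x : ℤ} (h : x ∈ S) : (block S x).Nonempty :=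
  ⟨x, by simp [block, h]⟩

/-- The occupied spots after the cars of a word have parked. The word is listed backwards, the most
recent car first. If the spot `val a` preferred by the new car `a` is free, then it parks there.
Otherwise `val a` lies in a maximal interval `I` of occupied spots; if `b` is the last earlier car
whose preferred spot lies in `I`, then the new car parks at `min I - 1` if `a < b` and at
`max I + 1` if `a > b`. (A car parks in the interval that then contains its preferred spot, so there
is always such a `b`: the case `none` does not arise.) -/
def spotsRev : List Letter → Finset ℤ
  | [] => ∅
  | a :: W =>
    if h : a.val ∈ spotsRev W then
      match W.find? (fun b => b.val ∈ block (spotsRev W) a.val) with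
      | some b =>
        if a < b then
          insert ((block (spotsRev W) a.val).min' (block_nonempty h) - 1) (spotsRev W)
        else
          insert ((block (spotsRev W) a.val).max' (block_nonempty h) + 1) (spotsRev W)
      | none => spotsRev W
    else
      insert a.val (spotsRev W)

/-- The set `Ω(W)` of occupied spots after the cars `W_1, W_2, …` have parked in this order. -/
def spots (W : List Letter) : Finset ℤ := spotsRev W.reverse

/-- `W` is an `Ω`-parking word: `Ω(W) = {1, …, |W|}`. -/
def IsParkingWord (W : List Letter) : Prop := spots W = Finset.Icc 1 (W.length : ℤ)

/-- The alphabet `ℤ_c` of the letters `i^(j)` with `1 ≤ i ≤ n - 1` and `1 ≤ j ≤ c_i`. -/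
def alphabet {m : ℕ} (c : Fin m → ℕ) : Set Letter :=
  {a | ∃ i : Fin m, a.val = (i : ℤ) + 1 ∧ (a.sup : ℕ) ≤ c i}

/-- The injective words of length `n - 1` in the alphabet `ℤ_c`. -/
def injectiveWords {m : ℕ} (c : Fin m → ℕ) : Set (List Letter) :=
  {W | W.Nodup ∧ W.length = m ∧ ∀ a ∈ W, a ∈ alphabet c}

end OmegaParking

/-! Write R_i for `omitVar i` and T_i f = (R_{i+1} f - R_i f) / x_i for `trim i`; both go from n + 1
variables to n. A polynomial is quasisymmetric exactly when all its R_i agree, so every T_i kills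
it. By the twisted Leibniz rule `trim_mul`, T_i maps the ideal into the ideal one variable down, and
it also preserves the span of the ABB monomials.

Uniqueness of the reduction follows by induction: for p in both the span and the ideal, all T_i p
vanish, so p is quasisymmetric. As its last variable does not occur, p is constant, hence zero.
Existence is a straightening argument on the last variable with fundamental quasisymmetric
polynomials (`mem_excessSpan_sup_excessIdeal`).

For the count, iterate the sum of all T_i down to one variable and take the constant coefficient
(`trimSum`). This functional vanishes on the ideal. On homogeneous ABB polynomials of top degree it
is evaluation at (1, ..., 1), by telescoping (`trimSum_eq_eval`). Since reduction preserves
homogeneity, the mixed Eulerian number is `trimSum` of y_c.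

Now y_c is a product of partial sums, one for each letter. The ordered Leibniz rule turns T_i of
such a product into a sum over the letters f of value i + 1: f is deleted and the other values are
changed by `contract` (`trim_prod_partialSum`). Deleting the first car f of a parking word together
with its spot changes the preferences of the other cars by the same `contract`
(`parked_append_singleton`). So `trimSum` and the number of parking orders satisfy the same
recursion (`trimSum_prod_partialSum`). -/

namespace OmegaParking

/-! ### Setting a variable to zero, and trimming operators -/

/-- The algebra map `ℚ[x_0, …, x_n] → ℚ[x_0, …, x_{n-1}]` that sets `x_i` to zero and shifts the
later variables down. -/
noncomputable def omitVar {n : ℕ} (i : Fin (n + 1)) :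
    MvPolynomial (Fin (n + 1)) ℚ →ₐ[ℚ] MvPolynomial (Fin n) ℚ :=
  aeval (i.insertNth 0 X)

@[simp] theorem omitVar_X_self {n : ℕ} (i : Fin (n + 1)) : omitVar i (X i) = 0 := by
  simp [omitVar]

@[simp] theorem omitVar_X_succAbove {n : ℕ} (i : Fin (n + 1)) (j : Fin n) :
    omitVar i (X (i.succAbove j)) = X j := by
  simp [omitVar]

/-- Insert a zero at position `i` of an exponent vector. -/
noncomputable def insertZero {n : ℕ} (i : Fin (n + 1)) (e : Fin n →₀ ℕ) : Fin (n + 1) →₀ ℕ :=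
  e.embDomain i.succAboveEmb

@[simp] theorem insertZero_self {n : ℕ} (i : Fin (n + 1)) (e : Fin n →₀ ℕ) :
    insertZero i e i = 0 :=
  Finsupp.embDomain_of_notMem_range _ _ _ (by simp)

@[simp] theorem insertZero_succAbove {n : ℕ} (i : Fin (n + 1)) (e : Fin n →₀ ℕ) (j : Fin n) :
    insertZero i e (i.succAbove j) = e j :=
  Finsupp.embDomain_apply_self i.succAboveEmb e j

theorem insertZero_eq_iff {n : ℕ} (i : Fin (n + 1)) (e : Fin n →₀ ℕ) (d : Fin (n + 1) →₀ ℕ) :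
    insertZero i e = d ↔ d i = 0 ∧ ∀ j, e j = d (i.succAbove j) := by
  constructor
  · rintro rfl; simp
  · rintro ⟨h, h'⟩
    ext k
    obtain rfl | ⟨j, rfl⟩ := Fin.eq_self_or_eq_succAbove i k
    · simp [h]
    · simp [h']

theorem exists_insertZero {n : ℕ} {i : Fin (n + 1)} {d : Fin (n + 1) →₀ ℕ} (h : d i = 0) :
    ∃ e, insertZero i e = d :=
  ⟨Finsupp.equivFunOnFinite.symm fun j => d (i.succAbove j),
    (insertZero_eq_iff _ _ _).2 ⟨h, fun j => by simp⟩⟩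

theorem omitVar_monomial {n : ℕ} (i : Fin (n + 1)) (d : Fin (n + 1) →₀ ℕ) (c : ℚ) :
    omitVar i (monomial d c) =
      if d i = 0 then monomial (Finsupp.equivFunOnFinite.symm fun j => d (i.succAbove j)) c
      else 0 := by
  rw [omitVar, aeval_monomial, Finsupp.prod_fintype _ _ (by simp), Fin.prod_univ_succAbove _ i]
  simp only [Fin.insertNth_apply_same, Fin.insertNth_apply_succAbove]
  split_ifs with h
  · rw [monomial_eq, Finsupp.prod_fintype _ _ (by simp)]
    simp [h, algebraMap_eq]
  · simp [h]

theorem coeff_omitVar {n : ℕ} (i : Fin (n + 1)) (f : MvPolynomial (Fin (n + 1)) ℚ)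
    (e : Fin n →₀ ℕ) : coeff e (omitVar i f) = coeff (insertZero i e) f := by
  induction f using MvPolynomial.induction_on' with
  | add p q hp hq => simp [hp, hq]
  | monomial d c =>
    rw [omitVar_monomial, coeff_monomial]
    by_cases h : d = insertZero i e
    · subst h
      simp only [insertZero_self, insertZero_succAbove, if_true, coeff_monomial]
      rw [if_pos]
      ext j; simp
    · rw [if_neg h]
      split_ifs with h0
      · rw [coeff_monomial, if_neg]
        rintro rfl
        exact h ((insertZero_eq_iff _ _ _).2 ⟨h0, fun j => by simp⟩).symm
      · simp

theorem constantCoeff_omitVar {n : ℕ} (i : Fin (n + 1)) (f : MvPolynomial (Fin (n + 1)) ℚ) :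
    constantCoeff (omitVar i f) = constantCoeff f := by
  rw [constantCoeff_eq, constantCoeff_eq, coeff_omitVar]
  congr 1

/-- Omitting the variable `i + 1` is the same as omitting `i` once `x_i` is set to zero. -/
theorem X_dvd_omitVar_sub {n : ℕ} (i : Fin n) (f : MvPolynomial (Fin (n + 1)) ℚ) :
    X i ∣ omitVar i.succ f - omitVar i.castSucc f := by
  rw [X_dvd_iff_modMonomial_eq_zero]
  ext e
  rw [coeff_zero]
  by_cases h : Finsupp.single i 1 ≤ e
  · exact coeff_modMonomial_of_le _ h
  · rw [coeff_modMonomial_of_not_le _ h, coeff_sub, coeff_omitVar, coeff_omitVar, sub_eq_zero]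
    have h0 : e i = 0 := by
      by_contra hne
      exact h (Finsupp.single_le_iff.2 (Nat.one_le_iff_ne_zero.2 hne))
    congr 1
    rw [insertZero_eq_iff]
    refine ⟨?_, fun j => ?_⟩
    · rw [show i.succ = i.castSucc.succAbove i by simp, insertZero_succAbove, h0]
    · rcases lt_trichotomy j i with hj | rfl | hj
      · rw [Fin.succAbove_succ_of_le _ _ hj.le, ← Fin.succAbove_castSucc_of_lt _ _ hj,
          insertZero_succAbove]
      · rw [Fin.succAbove_succ_self, insertZero_self, h0]
      · rw [Fin.succAbove_succ_of_lt _ _ hj, ← Fin.succAbove_castSucc_of_le _ _ hj.le,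
          insertZero_succAbove]

/-- The quasisymmetric divided difference `(f(…, x_i, 0, …) - f(…, 0, x_i, …)) / x_i`. -/
noncomputable def trim {n : ℕ} (i : Fin n) :
    MvPolynomial (Fin (n + 1)) ℚ →ₗ[ℚ] MvPolynomial (Fin n) ℚ where
  toFun f := (omitVar i.succ f - omitVar i.castSucc f).divMonomial (Finsupp.single i 1)
  map_add' f g := by rw [← add_divMonomial]; congr 1; simp; ring
  map_smul' c f := by ext e; simp [coeff_divMonomial, mul_sub]

theorem coeff_trim {n : ℕ} (i : Fin n) (f : MvPolynomial (Fin (n + 1)) ℚ) (e : Fin n →₀ ℕ) :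
    coeff e (trim i f) = coeff (insertZero i.succ (Finsupp.single i 1 + e)) f -
      coeff (insertZero i.castSucc (Finsupp.single i 1 + e)) f := by
  simp [trim, coeff_divMonomial, coeff_omitVar]

theorem X_mul_trim {n : ℕ} (i : Fin n) (f : MvPolynomial (Fin (n + 1)) ℚ) :
    X i * trim i f = omitVar i.succ f - omitVar i.castSucc f := by
  have := divMonomial_add_modMonomial_single (omitVar i.succ f - omitVar i.castSucc f) i
  rwa [X_dvd_iff_modMonomial_eq_zero.1 (X_dvd_omitVar_sub i f), add_zero] at this

/-! ### Quasisymmetric polynomials -/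

/-- Listing the support in increasing order gives the form in which quasisymmetry is stated, so
identities can be checked one coefficient at a time. -/
theorem exists_strictMono_sum_single {n : ℕ} (e : Fin n →₀ ℕ) :
    ∃ (k : ℕ) (α : Fin k → ℕ) (i : Fin k → Fin n), (∀ t, 0 < α t) ∧ StrictMono i ∧
      e = ∑ t, Finsupp.single (i t) (α t) := by
  refine ⟨e.support.card, fun t => e (e.support.orderEmbOfFin rfl t),
    e.support.orderEmbOfFin rfl, fun t => ?_, (e.support.orderEmbOfFin rfl).strictMono, ?_⟩
  · exact Nat.pos_of_ne_zero (Finsupp.mem_support_iff.1 (Finset.orderEmbOfFin_mem _ _ _))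
  · conv_lhs => rw [← Finsupp.sum_single e, Finsupp.sum,
      ← Finset.sum_coe_sort e.support fun a => Finsupp.single a (e a)]
    exact ((e.support.orderIsoOfFin rfl).toEquiv.sum_comp fun a : e.support =>
      Finsupp.single (a : Fin n) (e a)).symm

theorem insertZero_sum_single {n k : ℕ} (p : Fin (n + 1)) (α : Fin k → ℕ) (i : Fin k → Fin n) :
    insertZero p (∑ t, Finsupp.single (i t) (α t)) =
      ∑ t, Finsupp.single (p.succAbove (i t)) (α t) := by
  rw [insertZero, Finsupp.embDomain_eq_mapDomain, Finsupp.mapDomain_finsetSum]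
  simp

theorem IsQuasisymmetric.omitVar_eq {n : ℕ} {f : MvPolynomial (Fin (n + 1)) ℚ}
    (hf : IsQuasisymmetric f) (p q : Fin (n + 1)) : omitVar p f = omitVar q f := by
  ext e
  obtain ⟨k, α, i, hα, hi, rfl⟩ := exists_strictMono_sum_single e
  simp only [coeff_omitVar, insertZero_sum_single]
  exact hf k α _ _ hα ((Fin.strictMono_succAbove p).comp hi) ((Fin.strictMono_succAbove q).comp hi)

theorem IsQuasisymmetric.omitVar {n : ℕ} {f : MvPolynomial (Fin (n + 1)) ℚ}
    (hf : IsQuasisymmetric f) (p : Fin (n + 1)) : IsQuasisymmetric (omitVar p f) := by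
  intro k α i j hα hi hj
  simp only [coeff_omitVar, insertZero_sum_single]
  exact hf k α _ _ hα ((Fin.strictMono_succAbove p).comp hi) ((Fin.strictMono_succAbove p).comp hj)

theorem omitVar_omitVar_zero {n : ℕ} (i : Fin (n + 1)) (f : MvPolynomial (Fin (n + 2)) ℚ) :
    omitVar i (omitVar 0 f) = omitVar 0 (omitVar i.succ f) := by
  ext e
  simp only [coeff_omitVar]
  congr 1
  rw [insertZero_eq_iff]
  refine ⟨?_, fun j => ?_⟩
  · rw [← Fin.succ_succAbove_zero i, insertZero_succAbove, insertZero_self]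
  · rw [Fin.succAbove_zero]
    obtain rfl | ⟨j, rfl⟩ := Fin.eq_self_or_eq_succAbove i j
    · rw [insertZero_self, insertZero_self]
    · rw [insertZero_succAbove, ← Fin.succ_succAbove_succ, insertZero_succAbove,
        ← Fin.succAbove_zero, insertZero_succAbove]

theorem _root_.StrictMono.fin_eq {n : ℕ} {i j : Fin n → Fin n} (hi : StrictMono i)
    (hj : StrictMono j) : i = j :=
  hi.range_inj hj |>.1 <| by
    rw [(Finite.surjective_of_injective hi.injective).range_eq,
      (Finite.surjective_of_injective hj.injective).range_eq]

/-- A strictly increasing map into `Fin (n + 1)` that is not onto factors through some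
`Fin.succAbove p`. -/
theorem _root_.StrictMono.exists_succAbove_comp {n k : ℕ} {i : Fin k → Fin (n + 1)}
    (hi : StrictMono i) (hk : k ≠ n + 1) :
    ∃ (p : Fin (n + 1)) (i' : Fin k → Fin n), StrictMono i' ∧ i = p.succAbove ∘ i' := by
  have hs : ¬ Function.Surjective i := fun hs =>
    hk (by simpa using Fintype.card_of_bijective ⟨hi.injective, hs⟩)
  simp only [Function.Surjective, not_forall, not_exists] at hs
  obtain ⟨p, hp⟩ := hs
  choose i' hi' using fun t => Fin.exists_succAbove_eq (hp t)
  refine ⟨p, i', fun s t hst => ?_, funext fun t => (hi' t).symm⟩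
  rw [← (Fin.strictMono_succAbove p).lt_iff_lt, hi', hi']
  exact hi hst

/-- An increasing index sequence that uses all variables is unique, so such monomials impose no
condition. Any other sequence misses a variable p, and its coefficient is read off `omitVar p f`,
which may be replaced by `omitVar 0 f`. The latter inherits the hypothesis, so induction applies. -/
theorem isQuasisymmetric_of_omitVar_eq {n : ℕ} {f : MvPolynomial (Fin (n + 1)) ℚ}
    (h : ∀ p q, omitVar p f = omitVar q f) : IsQuasisymmetric f := by
  induction n with
  | zero =>
    intro k α i j hα hi hj
    rw [show i = j from funext fun t => Subsingleton.elim (α := Fin 1) _ _]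
  | succ n ih =>
    have hR : IsQuasisymmetric (omitVar 0 f) := by
      refine ih fun p q => ?_
      rw [omitVar_omitVar_zero, omitVar_omitVar_zero, h p.succ q.succ]
    intro k α i j hα hi hj
    by_cases hk : k = n + 2
    · subst hk
      rw [hi.fin_eq hj]
    · obtain ⟨p, i', hi', rfl⟩ := hi.exists_succAbove_comp hk
      obtain ⟨q, j', hj', rfl⟩ := hj.exists_succAbove_comp hk
      simp only [Function.comp_apply, ← insertZero_sum_single, ← coeff_omitVar, h p 0, h q 0]
      exact hR k α _ _ hα hi' hj'

/-! ### The trimming operators, the ideal and the ABB monomials -/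

/-- After multiplication by x_i this is the identity ab - a'b' = (a - a')b + a'(b - b'). -/
theorem trim_mul {n : ℕ} (i : Fin n) (f g : MvPolynomial (Fin (n + 1)) ℚ) :
    trim i (f * g) = trim i f * omitVar i.succ g + omitVar i.castSucc f * trim i g := by
  apply mul_left_cancel₀ (X_ne_zero i : (X i : MvPolynomial (Fin n) ℚ) ≠ 0)
  rw [mul_add, X_mul_trim, ← mul_assoc, X_mul_trim, mul_left_comm, X_mul_trim, map_mul, map_mul]
  ring

theorem IsQuasisymmetric.trim_eq_zero {n : ℕ} {g : MvPolynomial (Fin (n + 1)) ℚ}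
    (hg : IsQuasisymmetric g) (i : Fin n) : trim i g = 0 := by
  apply mul_left_cancel₀ (X_ne_zero i : (X i : MvPolynomial (Fin n) ℚ) ≠ 0)
  rw [X_mul_trim, hg.omitVar_eq i.succ i.castSucc, sub_self, mul_zero]

theorem omitVar_mem_qsymIdeal {n : ℕ} (i : Fin (n + 1)) {f : MvPolynomial (Fin (n + 1)) ℚ}
    (hf : f ∈ qsymIdeal (n + 1)) : omitVar i f ∈ qsymIdeal n := by
  have : qsymIdeal (n + 1) ≤ (qsymIdeal n).comap (omitVar i) :=
    Ideal.span_le.2 fun g hg => Ideal.subset_span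
      ⟨hg.1.omitVar i, (constantCoeff_omitVar i g).trans hg.2⟩
  exact this hf

/-- Generators are killed. In the Leibniz rule for p * f, one term contains `omitVar` of f and the
other contains `trim` of f; both lie in the ideal. -/
theorem trim_mem_qsymIdeal {n : ℕ} (i : Fin n) {f : MvPolynomial (Fin (n + 1)) ℚ}
    (hf : f ∈ qsymIdeal (n + 1)) : trim i f ∈ qsymIdeal n := by
  have hf' := hf
  rw [qsymIdeal] at hf
  induction hf using Submodule.span_induction with
  | mem g hg => rw [hg.1.trim_eq_zero]; exact zero_mem _
  | zero => simp
  | add f g hf0 hg0 hf hg => rw [map_add]; exact add_mem (hf hf0) (hg hg0)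
  | smul p f hf0 hf =>
    rw [smul_eq_mul, trim_mul]
    exact add_mem (Ideal.mul_mem_left _ _ (omitVar_mem_qsymIdeal _ hf0))
      (Ideal.mul_mem_left _ _ (hf hf0))

theorem constantCoeff_of_mem_qsymIdeal {n : ℕ} {f : MvPolynomial (Fin n) ℚ}
    (hf : f ∈ qsymIdeal n) : constantCoeff f = 0 := by
  have : qsymIdeal n ≤ RingHom.ker (constantCoeff (R := ℚ) (σ := Fin n)) :=
    Ideal.span_le.2 fun f hf => hf.2
  exact this hf

theorem mem_abbVectors_iff {n : ℕ} {d : Fin n →₀ ℕ} :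
    d ∈ abbVectors n ↔ ∀ i : Fin n, ∑ j ∈ Finset.Ici i, d j + i + 1 ≤ n := by
  have h : ∀ j : Fin n, ∑ i ∈ Finset.Iic j, d (Fin.rev i) = ∑ i ∈ Finset.Ici j.rev, d i := by
    intro j
    refine Finset.sum_nbij' Fin.rev Fin.rev ?_ ?_ ?_ ?_ ?_ <;> simp [Fin.rev_le_iff, Fin.le_rev_iff]
  simp only [abbVectors, Set.mem_ofPred_eq, h]
  refine ⟨fun H i => ?_, fun H j => ?_⟩
  · have := H i.rev
    rw [Fin.rev_rev, Fin.val_rev] at this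
    omega
  · have := H j.rev
    rw [Fin.val_rev] at this
    omega

theorem mem_abbSpan_iff {n : ℕ} {p : MvPolynomial (Fin n) ℚ} :
    p ∈ abbSpan n ↔ ∀ d, coeff d p ≠ 0 → d ∈ abbVectors n := by
  constructor
  · intro hp
    induction hp using Submodule.span_induction with
    | mem g hg =>
      obtain ⟨e, he, rfl⟩ := hg
      intro d hd
      rw [coeff_monomial] at hd
      split_ifs at hd with h
      · exact h ▸ he
      · exact absurd rfl hd
    | zero => simp
    | add f g _ _ hf hg =>
      intro d hd
      by_cases h : coeff d f = 0
      · rw [coeff_add, h, zero_add] at hd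
        exact hg d hd
      · exact hf d h
    | smul c f _ hf =>
      intro d hd
      exact hf d fun h => hd (by simp [h])
  · intro h
    rw [p.as_sum]
    refine sum_mem fun d hd => ?_
    rw [show monomial d (coeff d p) = coeff d p • monomial d (1 : ℚ) by simp [smul_monomial]]
    exact Submodule.smul_mem _ _ (Submodule.subset_span ⟨d, h d (mem_support_iff.1 hd), rfl⟩)

/-- Both exponent vectors occurring in `coeff_trim` have this shape. A tail starting at or before i
contains the extra unit at i, which pays for the lost variable; a tail starting after i is compared
with the tail one position later, whose bound is smaller by one. -/
theorem mem_abbVectors_of_insertZero {n : ℕ} {i : Fin n} {k : Fin (n + 1)} {e : Fin n →₀ ℕ}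
    (hk : k = i.succ ∨ k = i.castSucc)
    (h : insertZero k (Finsupp.single i 1 + e) ∈ abbVectors (n + 1)) : e ∈ abbVectors n := by
  rw [mem_abbVectors_iff] at h ⊢
  intro l
  have hkv : (k : ℕ) = i + 1 ∨ (k : ℕ) = i := hk.imp (by rintro rfl; simp) (by rintro rfl; simp)
  have hsum : ∀ {L : Fin (n + 1)}, (∀ j, L ≤ k.succAbove j ↔ l ≤ j) →
      ∑ j ∈ Finset.Ici L, insertZero k (Finsupp.single i 1 + e) j =
        (if l ≤ i then 1 else 0) + ∑ j ∈ Finset.Ici l, e j := by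
    intro L hL
    have hI : ∀ {N : ℕ} (a : Fin N), Finset.Ici a = Finset.univ.filter (a ≤ ·) := by
      intro N a; ext; simp
    rw [hI, hI, Finset.sum_filter, Finset.sum_filter, Fin.sum_univ_succAbove _ k]
    simp only [insertZero_self, insertZero_succAbove, hL, ite_self, zero_add, Finsupp.add_apply]
    rw [← Finset.sum_filter, Finset.sum_add_distrib, Finset.sum_filter, Finset.sum_filter]
    congr 1
    rw [Finset.sum_eq_single i] <;> simp +contextual [eq_comm]
  rcases le_or_gt l i with hl | hl
  · have := h l.castSucc
    rw [hsum, if_pos hl] at this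
    · simp only [Fin.val_castSucc] at this; omega
    · intro j
      rw [Fin.le_def] at hl
      simp only [Fin.succAbove, Fin.lt_def, Fin.le_def]
      split_ifs with hj <;> simp at hj ⊢ <;> omega
  · have := h l.succ
    rw [hsum, if_neg hl.not_ge] at this
    · simp only [Fin.val_succ] at this; omega
    · intro j
      rw [Fin.lt_def] at hl
      simp only [Fin.succAbove, Fin.lt_def, Fin.le_def]
      split_ifs with hj <;> simp at hj ⊢ <;> omega

theorem trim_mem_abbSpan {n : ℕ} (i : Fin n) {f : MvPolynomial (Fin (n + 1)) ℚ}
    (hf : f ∈ abbSpan (n + 1)) : trim i f ∈ abbSpan n := by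
  rw [mem_abbSpan_iff] at hf ⊢
  intro e he
  rw [coeff_trim] at he
  by_cases h : coeff (insertZero i.succ (Finsupp.single i 1 + e)) f = 0
  · rw [h, zero_sub, neg_ne_zero] at he
    exact mem_abbVectors_of_insertZero (Or.inr rfl) (hf _ he)
  · exact mem_abbVectors_of_insertZero (Or.inl rfl) (hf _ h)

/-- A quasisymmetric polynomial in which the last variable does not occur is constant. -/
theorem IsQuasisymmetric.eq_zero_of_mem_abbSpan {n : ℕ} {p : MvPolynomial (Fin (n + 1)) ℚ}
    (hp : IsQuasisymmetric p) (h : p ∈ abbSpan (n + 1)) (h0 : constantCoeff p = 0) : p = 0 := by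
  rw [mem_abbSpan_iff] at h
  ext d
  rw [coeff_zero]
  by_contra hd
  obtain ⟨k, α, i, hα, hi, rfl⟩ := exists_strictMono_sum_single d
  obtain _ | k := k
  · apply hd
    simpa [constantCoeff_eq] using h0
  have hk : k + 1 ≤ n + 1 := by simpa using Fintype.card_le_of_injective i hi.injective
  -- Quasisymmetry moves the monomial to the last k + 1 variables. There the last exponent is
  -- positive, which the ABB condition forbids.
  let j : Fin (k + 1) → Fin (n + 1) := fun t => ⟨t + (n - k), by omega⟩
  have hj : StrictMono j := fun s t hst => by
    simp only [j, Fin.lt_def] at hst ⊢; omega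
  rw [hp (k + 1) α i j hα hi hj] at hd
  have := mem_abbVectors_iff.1 (h _ hd) (Fin.last n)
  have hle : α (Fin.last k) ≤ (∑ t, Finsupp.single (j t) (α t)) (Fin.last n) := by
    rw [Finsupp.finsetSum_apply]
    refine le_trans ?_ (Finset.single_le_sum (fun _ _ => Nat.zero_le _)
      (Finset.mem_univ (Fin.last k)))
    rw [show j (Fin.last k) = Fin.last n by ext; simp [j]; omega]
    simp
  have hmem : (∑ t, Finsupp.single (j t) (α t)) (Fin.last n) ≤
      ∑ l ∈ Finset.Ici (Fin.last n), (∑ t, Finsupp.single (j t) (α t)) l :=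
    Finset.single_le_sum (f := fun l => (∑ t, Finsupp.single (j t) (α t)) l)
      (fun _ _ => Nat.zero_le _) (by simp)
  have := hα (Fin.last k)
  simp only [Fin.val_last] at *
  omega

theorem omitVar_eq_of_trim_eq_zero {n : ℕ} {p : MvPolynomial (Fin (n + 1)) ℚ}
    (h : ∀ i, trim i p = 0) (k : Fin (n + 1)) : omitVar k p = omitVar 0 p := by
  induction k using Fin.induction with
  | zero => rfl
  | succ i ih =>
    rw [← ih, ← sub_eq_zero, ← X_mul_trim, h, mul_zero]

/-- The ABB monomials are linearly independent modulo the ideal. -/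
theorem eq_zero_of_mem_abbSpan_of_mem_qsymIdeal {n : ℕ} {p : MvPolynomial (Fin n) ℚ}
    (h : p ∈ abbSpan n) (h' : p ∈ qsymIdeal n) : p = 0 := by
  induction n with
  | zero =>
    rw [eq_C_of_isEmpty p, ← constantCoeff_eq, constantCoeff_of_mem_qsymIdeal h', map_zero]
  | succ n ih =>
    have hT : ∀ i, trim i p = 0 := fun i => ih (trim_mem_abbSpan i h) (trim_mem_qsymIdeal i h')
    refine (isQuasisymmetric_of_omitVar_eq fun k l => ?_).eq_zero_of_mem_abbSpan h
      (constantCoeff_of_mem_qsymIdeal h')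
    rw [omitVar_eq_of_trim_eq_zero hT, omitVar_eq_of_trim_eq_zero hT l]

/-! ### The functional that sums the coefficients of the reduction in top degree -/

/-- The sum of the values of all `n`-fold compositions of trimming operators. -/
noncomputable def trimSum : (n : ℕ) → MvPolynomial (Fin (n + 1)) ℚ →ₗ[ℚ] ℚ
  | 0 => (constantCoeff (R := ℚ) (σ := Fin 1)).toAddMonoidHom.toRatLinearMap
  | n + 1 => trimSum n ∘ₗ ∑ i : Fin (n + 1), trim i

@[simp] theorem trimSum_zero (f : MvPolynomial (Fin 1) ℚ) :
    trimSum 0 f = constantCoeff f := rfl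

theorem trimSum_succ {n : ℕ} (f : MvPolynomial (Fin (n + 2)) ℚ) :
    trimSum (n + 1) f = trimSum n (∑ i : Fin (n + 1), trim i f) := by
  simp [trimSum]

theorem trimSum_eq_zero {n : ℕ} {f : MvPolynomial (Fin (n + 1)) ℚ} (hf : f ∈ qsymIdeal (n + 1)) :
    trimSum n f = 0 := by
  induction n with
  | zero => exact constantCoeff_of_mem_qsymIdeal hf
  | succ n ih =>
    rw [trimSum_succ]
    exact ih (sum_mem fun i _ => trim_mem_qsymIdeal i hf)

theorem eval_one_eq_sum {n : ℕ} (f : MvPolynomial (Fin n) ℚ) :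
    eval (fun _ => 1) f = ∑ d ∈ f.support, coeff d f := by
  simp [eval_eq]

theorem eval_one_omitVar {n : ℕ} (k : Fin (n + 1)) (f : MvPolynomial (Fin (n + 1)) ℚ) :
    eval (fun _ => 1) (omitVar k f) = ∑ d ∈ f.support, if d k = 0 then coeff d f else 0 := by
  conv_lhs => rw [f.as_sum, map_sum, map_sum]
  refine Finset.sum_congr rfl fun d _ => ?_
  rw [omitVar_monomial]
  split_ifs <;> simp [eval_monomial]

/-- At the point (1, ..., 1) the division by x_i is invisible, so the sum telescopes. -/
theorem eval_one_sum_trim {n : ℕ} (f : MvPolynomial (Fin (n + 1)) ℚ) :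
    eval (fun _ => 1) (∑ i, trim i f) =
      eval (fun _ => 1) (omitVar (Fin.last n) f) - eval (fun _ => 1) (omitVar 0 f) := by
  have h : ∀ i, eval (fun _ => 1) (trim i f) = eval (fun _ => 1) (omitVar i.succ f) -
      eval (fun _ => 1) (omitVar i.castSucc f) := fun i => by
    rw [← map_sub, ← X_mul_trim, map_mul, eval_X, one_mul]
  rw [map_sum, Finset.sum_congr rfl fun i _ => h i, Finset.sum_sub_distrib, sub_eq_sub_iff_add_eq_add,
    add_comm, ← Fin.sum_univ_succ (fun k => eval (fun _ => (1 : ℚ)) (omitVar k f)), Fin.sum_univ_castSucc,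
    add_comm]

theorem degree_insertZero {n : ℕ} (k : Fin (n + 1)) (e : Fin n →₀ ℕ) :
    (insertZero k e).degree = e.degree := by
  rw [Finsupp.degree_eq_sum, Finsupp.degree_eq_sum, Fin.sum_univ_succAbove _ k]
  simp

theorem isHomogeneous_iff_degree {n m : ℕ} {f : MvPolynomial (Fin n) ℚ} :
    f.IsHomogeneous m ↔ ∀ d, coeff d f ≠ 0 → d.degree = m := by
  simp only [IsHomogeneous, IsWeightedHomogeneous, Finsupp.degree_eq_weight_one, Pi.one_def]

theorem IsHomogeneous.trim {n m : ℕ} {f : MvPolynomial (Fin (n + 1)) ℚ}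
    (hf : f.IsHomogeneous (m + 1)) (i : Fin n) : (trim i f).IsHomogeneous m := by
  rw [isHomogeneous_iff_degree] at hf ⊢
  intro e he
  have key : ∀ k, coeff (insertZero k (Finsupp.single i 1 + e)) f ≠ 0 → e.degree = m := by
    intro k hk
    have := hf _ hk
    rw [degree_insertZero, map_add, Finsupp.degree_single] at this
    omega
  rw [coeff_trim] at he
  by_cases h : coeff (insertZero i.succ (Finsupp.single i 1 + e)) f = 0
  · rw [h, zero_sub, neg_ne_zero] at he
    exact key _ he
  · exact key _ h

theorem trimSum_eq_eval {n : ℕ} {f : MvPolynomial (Fin (n + 1)) ℚ} (hf : f ∈ abbSpan (n + 1))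
    (hdeg : f.IsHomogeneous n) : trimSum n f = eval (fun _ => 1) f := by
  induction n with
  | zero =>
    rw [isHomogeneous_iff_degree] at hdeg
    have : f = C (coeff 0 f) := by
      ext d
      rw [coeff_C]
      split_ifs with h
      · rw [h]
      · by_contra hd
        exact h ((Finsupp.degree_eq_zero_iff d).1 (hdeg d hd)).symm
    rw [trimSum_zero, this]
    simp
  | succ n ih =>
    rw [trimSum_succ, ih (sum_mem fun i _ => trim_mem_abbSpan i hf)
      (IsHomogeneous.sum _ _ _ fun i _ => IsHomogeneous.trim hdeg i), eval_one_sum_trim,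
      eval_one_omitVar, eval_one_omitVar, eval_one_eq_sum, ← Finset.sum_sub_distrib]
    refine Finset.sum_congr rfl fun d hd => ?_
    rw [mem_support_iff] at hd
    have hd1 := isHomogeneous_iff_degree.1 hdeg d hd
    have hd2 := mem_abbVectors_iff.1 (mem_abbSpan_iff.1 hf d hd)
    have hlast := hd2 (Fin.last _)
    have hone := hd2 1
    rw [Finsupp.degree_eq_sum, Fin.sum_univ_succ] at hd1
    have hle : d (Fin.last _) ≤ ∑ j ∈ Finset.Ici (Fin.last (n + 1)), d j :=
      Finset.single_le_sum (f := fun j => d j) (fun _ _ => Nat.zero_le _) (by simp)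
    have hsum : ∑ j ∈ Finset.Ici (1 : Fin (n + 2)), d j = ∑ i : Fin (n + 1), d i.succ := by
      have : Finset.Ici (1 : Fin (n + 2)) = Finset.univ.map (Fin.succEmb (n + 1)) := by
        ext j
        cases j using Fin.cases <;> simp [Fin.le_def]
      rw [this, Finset.sum_map]
      rfl
    rw [hsum] at hone
    simp only [Fin.val_last, Fin.val_one] at hlast hone
    -- The last exponent is 0 by the ABB condition. The exponents from position 1 on sum to at most
    -- n while the degree is n + 1, so the exponent at 0 is positive: every monomial contributes to
    -- the first term and none to the second.
    rw [if_pos (by omega), if_neg (by omega), sub_zero]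

/-! ### Existence of reductions -/

/-- The inclusion `ℚ[x_0, …, x_{k-1}] → ℚ[x_0, …, x_k]`. -/
noncomputable def addVar (k : ℕ) : MvPolynomial (Fin k) ℚ →ₐ[ℚ] MvPolynomial (Fin (k + 1)) ℚ :=
  rename Fin.castSucc

/-- The fundamental quasisymmetric polynomial in `k` variables of the composition obtained from
a list by reversing it and deleting its zeros. -/
noncomputable def fundamental : (k : ℕ) → List ℕ → MvPolynomial (Fin k) ℚ
  | 0, α => if α.sum = 0 then 1 else 0
  | _ + 1, [] => 1
  | k + 1, 0 :: α => fundamental (k + 1) α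
  | k + 1, (a + 1) :: α => ∑ i ∈ Finset.range (a + 2),
      X (Fin.last k) ^ i * addVar k (fundamental k ((a + 1 - i) :: α))

theorem omitVar_last_addVar {k : ℕ} (f : MvPolynomial (Fin k) ℚ) :
    omitVar (Fin.last k) (addVar k f) = f := by
  have : (omitVar (Fin.last k)).comp (addVar k) = AlgHom.id ℚ _ := by
    ext1 j
    simp only [AlgHom.comp_apply, addVar, rename_X, AlgHom.id_apply]
    rw [← Fin.succAbove_last_apply, omitVar_X_succAbove]
  exact DFunLike.congr_fun this f

theorem omitVar_castSucc_addVar {k : ℕ} (i : Fin (k + 1)) (f : MvPolynomial (Fin (k + 1)) ℚ) :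
    omitVar i.castSucc (addVar (k + 1) f) = addVar k (omitVar i f) := by
  have : (omitVar i.castSucc).comp (addVar (k + 1)) = (addVar k).comp (omitVar i) := by
    ext1 j
    simp only [AlgHom.comp_apply, addVar, rename_X]
    obtain rfl | ⟨j, rfl⟩ := Fin.eq_self_or_eq_succAbove i j
    · simp
    · rw [omitVar_X_succAbove, ← Fin.castSucc_succAbove_castSucc, omitVar_X_succAbove, rename_X]
  exact DFunLike.congr_fun this f

theorem omitVar_castSucc_X_last {k : ℕ} (i : Fin (k + 1)) :
    omitVar i.castSucc (X (Fin.last (k + 1))) = X (Fin.last k) := by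
  rw [← Fin.succ_last, ← Fin.succAbove_castSucc_of_le i (Fin.last k) (Fin.le_last i),
    omitVar_X_succAbove]

theorem fundamental_zero_cons (k : ℕ) (α : List ℕ) :
    fundamental k (0 :: α) = fundamental k α := by
  cases k <;> simp [fundamental]

theorem fundamental_nil (k : ℕ) : fundamental k [] = 1 := by
  cases k <;> simp [fundamental]

/-- Setting the last variable to zero leaves only the term with i = 0 of the recursion; omitting any
other variable commutes with the recursion. The result does not depend on the omitted variable,
which is the criterion for quasisymmetry. -/
theorem omitVar_fundamental {k : ℕ} (i : Fin (k + 1)) (α : List ℕ) :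
    omitVar i (fundamental (k + 1) α) = fundamental k α := by
  have hlast : ∀ {k : ℕ} (α : List ℕ),
      omitVar (Fin.last k) (fundamental (k + 1) α) = fundamental k α := by
    intro k α
    induction α with
    | nil => simp [fundamental_nil]
    | cons a α ih =>
      obtain _ | a := a
      · rw [fundamental_zero_cons, ih, fundamental_zero_cons]
      · rw [fundamental, map_sum, Finset.sum_range_succ']
        simp [omitVar_last_addVar]
  induction k generalizing α with
  | zero => rw [show i = Fin.last 0 from Subsingleton.elim (α := Fin 1) _ _, hlast]
  | succ k ihk =>
    cases i using Fin.lastCases with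
    | last => exact hlast α
    | cast i =>
      induction α with
      | nil => simp [fundamental_nil]
      | cons a α ih =>
        obtain _ | a := a
        · rw [fundamental_zero_cons, ih, fundamental_zero_cons]
        · rw [fundamental, map_sum, fundamental]
          simp only [map_mul, map_pow, omitVar_castSucc_X_last, omitVar_castSucc_addVar, ihk i]

theorem isQuasisymmetric_fundamental (k : ℕ) (α : List ℕ) : IsQuasisymmetric (fundamental k α) := by
  cases k with
  | zero =>
    intro k α i j _ _ _
    rw [show i = j from funext fun t => (i t).elim0]
  | succ k =>
    exact isQuasisymmetric_of_omitVar_eq fun p q => by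
      rw [omitVar_fundamental, omitVar_fundamental]

theorem constantCoeff_fundamental (k : ℕ) {α : List ℕ} (h : α.sum ≠ 0) :
    constantCoeff (fundamental k α) = 0 := by
  induction k with
  | zero => simp [fundamental, h]
  | succ k ih => rw [← constantCoeff_omitVar 0, omitVar_fundamental, ih]

/-- The last parts of a composition, listed backwards, exceed the length of some initial segment of
this list by at least `t`. -/
def HasExcess (t : ℕ) (α : List ℕ) : Prop :=
  ∃ j, 0 < j ∧ j ≤ α.length ∧ j + t ≤ (α.take j).sum

theorem hasExcess_cons {t a : ℕ} {α : List ℕ} :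
    HasExcess t (a :: α) ↔ t + 1 ≤ a ∨ ∃ j, 0 < j ∧ j ≤ α.length ∧ j + 1 + t ≤ a + (α.take j).sum := by
  constructor
  · rintro ⟨j, h0, h1, h2⟩
    obtain _ | _ | j := j
    · omega
    · left; simp at h2; omega
    · right; exact ⟨j + 1, by omega, by simpa using h1, by simpa using h2⟩
  · rintro (h | ⟨j, h0, h1, h2⟩)
    · exact ⟨1, by simp, by simp, by simp; omega⟩
    · exact ⟨j + 1, by simp, by simpa using h1, by simpa using h2⟩

/-- The ideal generated by the fundamental quasisymmetric polynomials in `k` variables with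
excess `t`. -/
noncomputable def excessIdeal (k t : ℕ) : Ideal (MvPolynomial (Fin k) ℚ) :=
  Ideal.span (fundamental k '' {α | HasExcess t α})

theorem excessIdeal_zero_le (n : ℕ) : excessIdeal n 0 ≤ qsymIdeal n := by
  refine Ideal.span_le.2 ?_
  rintro _ ⟨α, ⟨j, h0, _, h⟩, rfl⟩
  refine Ideal.subset_span ⟨isQuasisymmetric_fundamental n α, constantCoeff_fundamental n ?_⟩
  have := List.sum_take_add_sum_drop α j
  omega

/-- Solve the recursion for its term without the last variable x: for a > 0, F_k((a+1) :: α) =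
F_{k+1}((a+1) :: α) - x F_{k+1}(a :: α). Lowering a part by one costs one unit of excess. For a = 0
the subtracted term is x F_k(α), and the induction on the list applies. -/
theorem addVar_fundamental_mem {k t : ℕ} {α : List ℕ} (h : HasExcess (t + 1) α) :
    addVar k (fundamental k α) ∈ excessIdeal (k + 1) t := by
  induction α with
  | nil => obtain ⟨j, h0, h1, _⟩ := h; simp at h1; omega
  | cons a α ih =>
    rw [hasExcess_cons] at h
    obtain _ | a := a
    · rw [fundamental_zero_cons]
      refine ih ?_
      obtain h | ⟨j, h0, h1, h2⟩ := h
      · omega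
      · exact ⟨j, h0, h1, by omega⟩
    · have hmem : fundamental (k + 1) ((a + 1) :: α) ∈ excessIdeal (k + 1) t := by
        refine Ideal.subset_span ⟨_, hasExcess_cons.2 ?_, rfl⟩
        refine h.imp (by omega) ?_
        rintro ⟨j, h0, h1, h2⟩
        exact ⟨j, h0, h1, by omega⟩
      have hsub : ∀ i ∈ Finset.range (a + 1), X (Fin.last k) ^ (i + 1) *
          addVar k (fundamental k ((a + 1 - (i + 1)) :: α)) =
          X (Fin.last k) * (X (Fin.last k) ^ i * addVar k (fundamental k ((a - i) :: α))) := by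
        intro i _
        rw [pow_succ', mul_assoc, Nat.add_sub_add_right]
      rw [fundamental, Finset.sum_range_succ', Finset.sum_congr rfl hsub, ← Finset.mul_sum] at hmem
      simp only [pow_zero, one_mul, Nat.sub_zero] at hmem
      refine (Ideal.add_mem_iff_right _ (Ideal.mul_mem_left _ _ ?_)).1 hmem
      obtain _ | a := a
      · simp only [zero_add, Finset.range_one, Finset.sum_singleton, pow_zero, one_mul, Nat.sub_zero,
          fundamental_zero_cons]
        refine ih ?_
        obtain h | ⟨j, h0, h1, h2⟩ := h
        · omega
        · exact ⟨j, h0, h1, by omega⟩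
      · rw [← fundamental]
        refine Ideal.subset_span ⟨_, hasExcess_cons.2 ?_, rfl⟩
        refine h.imp (by omega) ?_
        rintro ⟨j, h0, h1, h2⟩
        exact ⟨j, h0, h1, by omega⟩

/-- The span of the monomials `x^d` in `k` variables with
`d_{k-1} + ⋯ + d_{k-j} < j + t` for `j = 1, …, k`. -/
noncomputable def excessSpan (k t : ℕ) : Submodule ℚ (MvPolynomial (Fin k) ℚ) :=
  Submodule.span ℚ
    ((fun d => monomial d (1 : ℚ)) '' {d | ∀ i : Fin k, ∑ j ∈ Finset.Ici i, d j + i + 1 ≤ k + t})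

theorem excessSpan_zero (n : ℕ) : excessSpan n 0 = abbSpan n := by
  simp only [excessSpan, abbSpan, add_zero]
  congr 2
  ext d
  rw [mem_abbVectors_iff]
  rfl

theorem addVar_monomial {k : ℕ} (d : Fin k →₀ ℕ) (c : ℚ) :
    addVar k (monomial d c) = monomial (insertZero (Fin.last k) d) c := by
  rw [addVar, rename_monomial, insertZero, Finsupp.embDomain_eq_mapDomain]
  congr 2
  ext j
  simp

theorem addVar_monomial_mul_pow {k : ℕ} (d : Fin k →₀ ℕ) (c : ℚ) (e : ℕ) :
    addVar k (monomial d c) * X (Fin.last k) ^ e =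
      monomial (insertZero (Fin.last k) d + Finsupp.single (Fin.last k) e) c := by
  rw [addVar_monomial, X_pow_eq_monomial, monomial_mul, mul_one]

theorem addVar_mul_pow_mem_excessSpan {k t e : ℕ} (he : e ≤ t) {f : MvPolynomial (Fin k) ℚ}
    (hf : f ∈ excessSpan k (t - e + 1)) :
    addVar k f * X (Fin.last k) ^ e ∈ excessSpan (k + 1) t := by
  induction hf using Submodule.span_induction with
  | mem g hg =>
    obtain ⟨d, hd, rfl⟩ := hg
    refine Submodule.subset_span ⟨_, ?_, (addVar_monomial_mul_pow d 1 e).symm⟩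
    intro i
    have hI : ∀ {N : ℕ} (a : Fin N), Finset.Ici a = Finset.univ.filter (a ≤ ·) := by
      intro N a; ext; simp
    rw [hI, Finset.sum_filter, Fin.sum_univ_castSucc]
    have hc : ∀ j : Fin k, insertZero (Fin.last k) d j.castSucc = d j := fun j => by
      rw [← Fin.succAbove_last_apply, insertZero_succAbove]
    simp only [Finsupp.add_apply, hc, insertZero_self, Fin.le_last, if_true, Finsupp.single_eq_same,
      Finsupp.single_apply, (Fin.castSucc_lt_last _).ne', if_false, add_zero, zero_add]
    cases i using Fin.lastCases with
    | last =>
      simp only [Fin.last_le_iff, (Fin.castSucc_lt_last _).ne, if_false, Finset.sum_const_zero,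
        Fin.val_last]
      omega
    | cast i =>
      have := hd i
      simp only [Fin.castSucc_le_castSucc_iff]
      rw [← Finset.sum_filter, ← hI, Fin.val_castSucc]
      omega
  | zero => simp
  | add f g _ _ hf hg => rw [map_add, add_mul]; exact add_mem hf hg
  | smul c f _ hf => rw [map_smul, smul_mul_assoc]; exact Submodule.smul_mem _ _ hf

/-- The generator for e :: α has x^e F_k(α) as its term of highest degree in the last variable x.
Modulo the ideal this term can be traded for lower powers of x. -/
theorem addVar_mul_pow_mem_of_hasExcess {k t e : ℕ} {α : List ℕ} (h : HasExcess t (e :: α))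
    (he : e ≠ 0)
    (W : Submodule ℚ (MvPolynomial (Fin (k + 1)) ℚ))
    (hW : (excessIdeal (k + 1) t).restrictScalars ℚ ≤ W)
    (hlt : ∀ i < e, ∀ f, addVar k f * X (Fin.last k) ^ i ∈ W) (p : MvPolynomial (Fin k) ℚ) :
    addVar k (p * fundamental k α) * X (Fin.last k) ^ e ∈ W := by
  obtain ⟨e, rfl⟩ := Nat.exists_eq_succ_of_ne_zero he
  have hmem : addVar k p * fundamental (k + 1) ((e + 1) :: α) ∈ W :=
    hW (Ideal.mul_mem_left _ _ (Ideal.subset_span ⟨_, h, rfl⟩))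
  rw [fundamental, Finset.sum_range_succ, mul_add, Finset.mul_sum] at hmem
  have hsum : ∑ i ∈ Finset.range (e + 1), addVar k p *
      (X (Fin.last k) ^ i * addVar k (fundamental k ((e + 1 - i) :: α))) ∈ W := by
    refine sum_mem fun i hi => ?_
    rw [mul_left_comm, ← map_mul, mul_comm]
    exact hlt i (by simpa using hi) _
  have := (W.add_mem_iff_right hsum).1 hmem
  rwa [Nat.sub_self, fundamental_zero_cons, mul_left_comm, ← map_mul, mul_comm] at this

/-- The bound t must vary for the induction on k: fixing the exponent e ≤ t of the last variable
leaves the same problem in k variables with bound t - e + 1. Powers with e > t are themselves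
reducible. An inner strong induction on e absorbs the lower powers. -/
theorem mem_excessSpan_sup_excessIdeal (k t : ℕ) (f : MvPolynomial (Fin k) ℚ) :
    f ∈ excessSpan k t ⊔ (excessIdeal k t).restrictScalars ℚ := by
  induction k generalizing t with
  | zero =>
    refine Submodule.mem_sup_left ?_
    rw [eq_C_of_isEmpty f, show C (coeff 0 f) = coeff 0 f • monomial 0 (1 : ℚ) by
      rw [smul_monomial, smul_eq_mul, mul_one]; rfl]
    exact Submodule.smul_mem _ _ (Submodule.subset_span ⟨0, fun i => i.elim0, rfl⟩)
  | succ k ih =>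
    set W := excessSpan (k + 1) t ⊔ (excessIdeal (k + 1) t).restrictScalars ℚ with hW
    have key : ∀ e f, addVar k f * X (Fin.last k) ^ e ∈ W := by
      intro e
      induction e using Nat.strong_induction_on with
      | _ e ihe =>
      intro f
      rcases le_or_gt e t with he | he
      · obtain ⟨b, hb, g, hg, rfl⟩ := Submodule.mem_sup.1 (ih (t - e + 1) f)
        rw [map_add, add_mul]
        refine add_mem (Submodule.mem_sup_left (addVar_mul_pow_mem_excessSpan he hb)) ?_
        rw [Submodule.restrictScalars_mem, excessIdeal] at hg
        -- The multiplier p absorbs the coefficients in the induction over the ideal, since the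
        -- target is only a ℚ-subspace.
        suffices ∀ p, addVar k (p * g) * X (Fin.last k) ^ e ∈ W by simpa using this 1
        induction hg using Submodule.span_induction with
        | mem g hg =>
          intro p
          obtain ⟨α, hα, rfl⟩ := hg
          rcases eq_or_ne e 0 with rfl | he0
          · rw [pow_zero, mul_one, map_mul]
            exact Submodule.mem_sup_right (Ideal.mul_mem_left _ _ (addVar_fundamental_mem hα))
          · obtain ⟨j, h0, h1, h2⟩ := hα
            exact addVar_mul_pow_mem_of_hasExcess
              (hasExcess_cons.2 (Or.inr ⟨j, h0, h1, by omega⟩)) he0 W le_sup_right ihe p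
        | zero => simp
        | add f g _ _ hf hg =>
          intro p
          rw [mul_add, map_add, add_mul]
          exact add_mem (hf p) (hg p)
        | smul q g _ hg =>
          intro p
          rw [smul_eq_mul, ← mul_assoc]
          exact hg (p * q)
      · have := addVar_mul_pow_mem_of_hasExcess (k := k) (α := []) (hasExcess_cons.2 (Or.inl he))
          (by omega) W le_sup_right ihe f
        rwa [fundamental_nil, mul_one] at this
    induction f using MvPolynomial.induction_on' with
    | add f g hf hg => exact add_mem hf hg
    | monomial d c =>
      obtain ⟨e, he⟩ := exists_insertZero (i := Fin.last k)
        (d := d.erase (Fin.last k)) Finsupp.erase_same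
      have := key (d (Fin.last k)) (monomial e c)
      rwa [addVar_monomial_mul_pow, he, Finsupp.erase_add_single] at this

theorem exists_isABBReduction {n : ℕ} (f : MvPolynomial (Fin n) ℚ) : ∃ r, IsABBReduction f r := by
  obtain ⟨r, hr, g, hg, rfl⟩ := Submodule.mem_sup.1 (mem_excessSpan_sup_excessIdeal n 0 f)
  exact ⟨r, excessSpan_zero n ▸ hr, by simpa using excessIdeal_zero_le n hg⟩

theorem existsUnique_isABBReduction {n : ℕ} (f : MvPolynomial (Fin n) ℚ) :
    ∃! r, IsABBReduction f r := by
  obtain ⟨r, hr, hr'⟩ := exists_isABBReduction f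
  refine ⟨r, ⟨hr, hr'⟩, fun s hs => ?_⟩
  rw [← sub_eq_zero]
  exact eq_zero_of_mem_abbSpan_of_mem_qsymIdeal (sub_mem hs.1 hr)
    (by simpa using sub_mem hr' hs.2)

/-! ### Homogeneity of the reduction -/

/-- The substitution `x_i ↦ 2 x_i`. -/
noncomputable def dilate (n : ℕ) : MvPolynomial (Fin n) ℚ →ₐ[ℚ] MvPolynomial (Fin n) ℚ :=
  aeval fun i => (2 : ℚ) • X i

theorem coeff_dilate {n : ℕ} (f : MvPolynomial (Fin n) ℚ) (d : Fin n →₀ ℕ) :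
    coeff d (dilate n f) = 2 ^ d.degree * coeff d f := by
  induction f using MvPolynomial.induction_on' with
  | add f g hf hg => rw [map_add, coeff_add, coeff_add, hf, hg, mul_add]
  | monomial e c =>
    have : dilate n (monomial e c) = monomial e (2 ^ e.degree * c) := by
      rw [dilate, aeval_monomial, Finsupp.prod_fintype _ _ (by simp), monomial_eq,
        Finsupp.prod_fintype _ _ (by simp), Finsupp.degree_eq_sum]
      simp only [smul_eq_C_mul, mul_pow, Finset.prod_mul_distrib, Finset.prod_pow_eq_pow_sum,
        algebraMap_eq, map_mul, map_pow]
      ring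
    rw [this, coeff_monomial, coeff_monomial]
    split_ifs with h
    · rw [h]
    · simp

theorem dilate_mem_qsymIdeal {n : ℕ} {f : MvPolynomial (Fin n) ℚ} (hf : f ∈ qsymIdeal n) :
    dilate n f ∈ qsymIdeal n := by
  have : qsymIdeal n ≤ (qsymIdeal n).comap (dilate n) := by
    refine Ideal.span_le.2 fun g hg => Ideal.subset_span ⟨fun k α i j hα hi hj => ?_, ?_⟩
    · rw [coeff_dilate, coeff_dilate, hg.1 k α i j hα hi hj]
      simp
    · rw [constantCoeff_eq, coeff_dilate, ← constantCoeff_eq, hg.2, mul_zero]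
  exact this hf

/-- Dilation preserves the ideal and the ABB span and multiplies f by 2^m. By uniqueness it
multiplies r by 2^m too, and the eigenvalue 2^m determines the degree. -/
theorem IsABBReduction.isHomogeneous {n m : ℕ} {f r : MvPolynomial (Fin n) ℚ}
    (hf : f.IsHomogeneous m) (hr : IsABBReduction f r) : r.IsHomogeneous m := by
  have hfm : dilate n f = (2 : ℚ) ^ m • f := by
    ext d
    rw [coeff_dilate, coeff_smul, smul_eq_mul]
    by_cases h : coeff d f = 0
    · rw [h, mul_zero, mul_zero]
    · rw [isHomogeneous_iff_degree.1 hf d h]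
  have h0 : dilate n r - (2 : ℚ) ^ m • r = 0 := by
    apply eq_zero_of_mem_abbSpan_of_mem_qsymIdeal
    · refine sub_mem ?_ (Submodule.smul_mem _ _ hr.1)
      refine mem_abbSpan_iff.2 fun d hd => mem_abbSpan_iff.1 hr.1 d fun h => hd ?_
      rw [coeff_dilate, h, mul_zero]
    · have h1 := dilate_mem_qsymIdeal hr.2
      have h2 := Submodule.smul_of_tower_mem (qsymIdeal n) ((2 : ℚ) ^ m) hr.2
      have h3 := sub_mem h2 h1
      rw [map_sub, hfm, smul_sub] at h3
      simpa using h3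
  rw [isHomogeneous_iff_degree]
  intro d hd
  have := congrArg (coeff d) h0
  rw [coeff_sub, coeff_dilate, coeff_smul, smul_eq_mul, coeff_zero, ← sub_mul, mul_eq_zero,
    or_iff_left hd, sub_eq_zero] at this
  exact pow_right_injective₀ (by norm_num) (by norm_num) this

/-! ### Contracting the spot of the first car -/

/-- All integers between `x` and `y` lie in `S`. -/
def Linked (S : Finset ℤ) (x y : ℤ) : Prop := ∀ z, min x y ≤ z → z ≤ max x y → z ∈ S

theorem mem_block_iff {S : Finset ℤ} {x y : ℤ} : y ∈ block S x ↔ Linked S x y := by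
  rw [block, Finset.mem_filter, Linked]
  simp only [Finset.subset_iff, Finset.uIcc, Finset.mem_Icc]
  exact ⟨fun h z h1 h2 => h.2 ⟨h1, h2⟩, fun h => ⟨h y (by simp) (by simp), fun z hz => h z hz.1 hz.2⟩⟩

theorem Linked.left_mem {S : Finset ℤ} {x y : ℤ} (h : Linked S x y) : x ∈ S :=
  h x (by simp) (by simp)

theorem Linked.right_mem {S : Finset ℤ} {x y : ℤ} (h : Linked S x y) : y ∈ S :=
  h y (by simp) (by simp)

theorem linked_self {S : Finset ℤ} {x : ℤ} (h : x ∈ S) : Linked S x x := by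
  intro z h1 h2
  rwa [show z = x by simp at h1 h2; omega]

theorem Linked.symm {S : Finset ℤ} {x y : ℤ} (h : Linked S x y) : Linked S y x :=
  fun z h1 h2 => h z (by omega) (by omega)

theorem Linked.trans {S : Finset ℤ} {x y z : ℤ} (h : Linked S x y) (h' : Linked S y z) :
    Linked S x z := by
  intro w h1 h2
  by_cases hw : min x y ≤ w ∧ w ≤ max x y
  · exact h w hw.1 hw.2
  · exact h' w (by omega) (by omega)

theorem Linked.mono {S T : Finset ℤ} {x y : ℤ} (h : Linked S x y) (hST : S ⊆ T) : Linked T x y :=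
  fun z h1 h2 => hST (h z h1 h2)

/-- `l` is the free spot to the left of the interval of `S` that contains `x`. -/
structure IsLeftSpot (S : Finset ℤ) (x l : ℤ) : Prop where
  notMem : l ∉ S
  lt : l < x
  linked : Linked S (l + 1) x

/-- `r` is the free spot to the right of the interval of `S` that contains `x`. -/
structure IsRightSpot (S : Finset ℤ) (x r : ℤ) : Prop where
  notMem : r ∉ S
  lt : x < r
  linked : Linked S x (r - 1)

theorem IsLeftSpot.unique {S : Finset ℤ} {x l l' : ℤ} (h : IsLeftSpot S x l)
    (h' : IsLeftSpot S x l') : l = l' := by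
  rcases lt_trichotomy l l' with hl | hl | hl
  · exact absurd (h.linked l' (by omega) (by have := h'.lt; omega)) h'.notMem
  · exact hl
  · exact absurd (h'.linked l (by omega) (by have := h.lt; omega)) h.notMem

theorem IsRightSpot.unique {S : Finset ℤ} {x r r' : ℤ} (h : IsRightSpot S x r)
    (h' : IsRightSpot S x r') : r = r' := by
  rcases lt_trichotomy r r' with hl | hl | hl
  · exact absurd (h'.linked r (by have := h.lt; omega) (by omega)) h.notMem
  · exact hl
  · exact absurd (h.linked r' (by have := h'.lt; omega) (by omega)) h'.notMem

theorem IsLeftSpot.of_linked {S : Finset ℤ} {x y l : ℤ} (h : IsLeftSpot S x l)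
    (hxy : Linked S x y) : IsLeftSpot S y l := by
  refine ⟨h.notMem, ?_, h.linked.trans hxy⟩
  by_contra hy
  exact h.notMem (hxy l (by omega) (by have := h.lt; omega))

theorem IsRightSpot.of_linked {S : Finset ℤ} {x y r : ℤ} (h : IsRightSpot S x r)
    (hxy : Linked S x y) : IsRightSpot S y r := by
  refine ⟨h.notMem, ?_, hxy.symm.trans h.linked⟩
  by_contra hy
  exact h.notMem (hxy r (by have := h.lt; omega) (by omega))

theorem isLeftSpot_min' {S : Finset ℤ} {x : ℤ} (h : x ∈ S) :
    IsLeftSpot S x ((block S x).min' (block_nonempty h) - 1) := by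
  have hM := Finset.min'_mem _ (block_nonempty h)
  have hx := Finset.min'_le _ x (mem_block_iff.2 (linked_self h))
  set M := (block S x).min' (block_nonempty h)
  rw [mem_block_iff] at hM
  refine ⟨fun hmem => ?_, by omega, by rw [sub_add_cancel]; exact hM.symm⟩
  have : M ≤ M - 1 := Finset.min'_le _ _ <| mem_block_iff.2 <| hM.trans fun z h1 h2 => by
    rcases (by omega : z = M - 1 ∨ z = M) with rfl | rfl
    · exact hmem
    · exact hM.right_mem
  omega

theorem isRightSpot_max' {S : Finset ℤ} {x : ℤ} (h : x ∈ S) :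
    IsRightSpot S x ((block S x).max' (block_nonempty h) + 1) := by
  have hM := Finset.max'_mem _ (block_nonempty h)
  have hx := Finset.le_max' _ x (mem_block_iff.2 (linked_self h))
  set M := (block S x).max' (block_nonempty h)
  rw [mem_block_iff] at hM
  refine ⟨fun hmem => ?_, by omega, by rw [add_sub_cancel_right]; exact hM⟩
  have : M + 1 ≤ M := Finset.le_max' _ _ <| mem_block_iff.2 <| hM.trans fun z h1 h2 => by
    rcases (by omega : z = M + 1 ∨ z = M) with rfl | rfl
    · exact hmem
    · exact hM.right_mem
  omega

/-! ### Parking cars with arbitrary monotone preferences -/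

section Parking

variable {α : Type*} [LinearOrder α]

/-- The procedure `spotsRev` for cars from an ordered set with preferred spots `v`. -/
def parked (v : α → ℤ) : List α → Finset ℤ
  | [] => ∅
  | a :: W =>
    if h : v a ∈ parked v W then
      match W.find? (fun b => v b ∈ block (parked v W) (v a)) with
      | some b =>
        if a < b then
          insert ((block (parked v W) (v a)).min' (block_nonempty h) - 1) (parked v W)
        else
          insert ((block (parked v W) (v a)).max' (block_nonempty h) + 1) (parked v W)
      | none => parked v W
    else
      insert (v a) (parked v W)

theorem parked_cons_of_notMem {v : α → ℤ} {a : α} {W : List α} (h : v a ∉ parked v W) :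
    parked v (a :: W) = insert (v a) (parked v W) := by
  rw [parked, dif_neg h]

theorem parked_cons_of_lt {v : α → ℤ} {a b : α} {W : List α} {l : ℤ}
    (hb : W.find? (fun b => v b ∈ block (parked v W) (v a)) = some b) (hab : a < b)
    (hl : IsLeftSpot (parked v W) (v a) l) : parked v (a :: W) = insert l (parked v W) := by
  have h : v a ∈ parked v W := hl.linked.right_mem
  rw [parked, dif_pos h, hb]
  simp only [if_pos hab, (isLeftSpot_min' h).unique hl]

theorem parked_cons_of_not_lt {v : α → ℤ} {a b : α} {W : List α} {r : ℤ}
    (hb : W.find? (fun b => v b ∈ block (parked v W) (v a)) = some b) (hab : ¬ a < b)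
    (hr : IsRightSpot (parked v W) (v a) r) : parked v (a :: W) = insert r (parked v W) := by
  have h : v a ∈ parked v W := hr.linked.left_mem
  rw [parked, dif_pos h, hb]
  simp only [if_neg hab, (isRightSpot_max' h).unique hr]

theorem parked_cons_cases (v : α → ℤ) (a : α) (W : List α) :
    (v a ∉ parked v W ∧ parked v (a :: W) = insert (v a) (parked v W)) ∨
    (v a ∈ parked v W ∧ parked v (a :: W) = parked v W) ∨
    (∃ l, IsLeftSpot (parked v W) (v a) l ∧ parked v (a :: W) = insert l (parked v W)) ∨
    ∃ r, IsRightSpot (parked v W) (v a) r ∧ parked v (a :: W) = insert r (parked v W) := by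
  by_cases h : v a ∈ parked v W
  · right
    rcases hb : W.find? (fun b => v b ∈ block (parked v W) (v a)) with _ | b
    · left
      rw [parked, dif_pos h, hb]
      exact ⟨h, rfl⟩
    · right
      by_cases hab : a < b
      · exact Or.inl ⟨_, isLeftSpot_min' h, parked_cons_of_lt hb hab (isLeftSpot_min' h)⟩
      · exact Or.inr ⟨_, isRightSpot_max' h, parked_cons_of_not_lt hb hab (isRightSpot_max' h)⟩
  · exact Or.inl ⟨h, parked_cons_of_notMem h⟩

theorem parked_subset_cons (v : α → ℤ) (a : α) (W : List α) :
    parked v W ⊆ parked v (a :: W) := by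
  rcases parked_cons_cases v a W with ⟨_, h⟩ | ⟨_, h⟩ | ⟨_, _, h⟩ | ⟨_, _, h⟩ <;> rw [h] <;> simp

theorem apply_mem_parked {v : α → ℤ} {W : List α} {b : α} (hb : b ∈ W) : v b ∈ parked v W := by
  induction W with
  | nil => simp at hb
  | cons a W ih =>
    rcases List.mem_cons.1 hb with rfl | hb
    · rcases parked_cons_cases v b W with ⟨_, h⟩ | ⟨h, _⟩ | ⟨_, h, _⟩ | ⟨_, h, _⟩
      · simp [h]
      · exact parked_subset_cons v b W h
      · exact parked_subset_cons v b W h.linked.right_mem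
      · exact parked_subset_cons v b W h.linked.left_mem
    · exact parked_subset_cons v a W (ih hb)

theorem exists_linked_of_mem_parked {v : α → ℤ} {W : List α} {x : ℤ} (hx : x ∈ parked v W) :
    ∃ b ∈ W, Linked (parked v W) x (v b) := by
  induction W with
  | nil => simp [parked] at hx
  | cons a W ih =>
    have hsub := parked_subset_cons v a W
    by_cases hxW : x ∈ parked v W
    · obtain ⟨b, hb, h⟩ := ih hxW
      exact ⟨b, List.mem_cons_of_mem _ hb, h.mono hsub⟩
    · refine ⟨a, List.mem_cons_self, ?_⟩
      rcases parked_cons_cases v a W with ⟨_, h⟩ | ⟨_, h⟩ | ⟨l, hl, h⟩ | ⟨r, hr, h⟩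
      · rw [h, Finset.mem_insert, or_iff_left hxW] at hx
        rw [← hx] at h ⊢
        exact linked_self (by simp [h])
      · exact absurd (h ▸ hx) hxW
      · rw [h, Finset.mem_insert, or_iff_left hxW] at hx
        subst hx
        refine Linked.trans (fun z h1 h2 => ?_) (hl.linked.mono hsub)
        rcases (by omega : z = x ∨ z = x + 1) with rfl | rfl
        · simp [h]
        · exact hsub hl.linked.left_mem
      · rw [h, Finset.mem_insert, or_iff_left hxW] at hx
        subst hx
        refine Linked.trans (fun z h1 h2 => ?_) (hr.linked.symm.mono hsub)
        rcases (by omega : z = x ∨ z = x - 1) with rfl | rfl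
        · simp [h]
        · exact hsub hr.linked.right_mem

/-- Renumber the spots so that the spot `i` becomes available as a new one. -/
def skip (i s : ℤ) : ℤ := if s < i then s else s + 1

/-- Insert an occupied spot `i`. -/
def expand (i : ℤ) (S : Finset ℤ) : Finset ℤ := insert i (S.image (skip i))

theorem skip_mem_expand {i s : ℤ} {S : Finset ℤ} : skip i s ∈ expand i S ↔ s ∈ S := by
  have hi : skip i s ≠ i := by unfold skip; split_ifs <;> omega
  have hinj : Function.Injective (skip i) := fun a b h => by
    unfold skip at h; split_ifs at h <;> omega
  rw [expand, Finset.mem_insert, or_iff_right hi, hinj.mem_finset_image]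

theorem self_mem_expand (i : ℤ) (S : Finset ℤ) : i ∈ expand i S := by simp [expand]

theorem eq_or_exists_skip (i z : ℤ) : z = i ∨ ∃ s, z = skip i s := by
  rcases lt_trichotomy z i with h | h | h
  · exact Or.inr ⟨z, by simp [skip, h]⟩
  · exact Or.inl h
  · exact Or.inr ⟨z - 1, by rw [skip, if_neg (by omega)]; omega⟩

theorem skip_le_skip {i s t : ℤ} : skip i s ≤ skip i t ↔ s ≤ t := by
  unfold skip; split_ifs <;> omega

/-- The renumbering preserves order and the only new spot is occupied, so intervals are neither
joined nor separated. -/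
theorem linked_skip {i s t : ℤ} {S : Finset ℤ} :
    Linked (expand i S) (skip i s) (skip i t) ↔ Linked S s t := by
  constructor
  · intro h z h1 h2
    rw [← skip_mem_expand (i := i)]
    apply h <;> simp only [min_le_iff, le_max_iff, skip_le_skip] <;> omega
  · intro h z h1 h2
    obtain rfl | ⟨z, rfl⟩ := eq_or_exists_skip i z
    · exact self_mem_expand _ _
    · rw [skip_mem_expand]
      simp only [min_le_iff, le_max_iff, skip_le_skip] at h1 h2
      exact h z (by omega) (by omega)

theorem expand_insert (i s : ℤ) (S : Finset ℤ) :
    expand i (insert s S) = insert (skip i s) (expand i S) := by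
  rw [expand, Finset.image_insert, expand, Finset.insert_comm]

theorem IsLeftSpot.skip {i x l : ℤ} {S : Finset ℤ} (h : IsLeftSpot S x l) :
    IsLeftSpot (expand i S) (skip i x) (skip i l) := by
  refine ⟨by rw [skip_mem_expand]; exact h.notMem, ?_, fun z h1 h2 => ?_⟩
  · rw [← not_le, skip_le_skip, not_le]; exact h.lt
  · obtain rfl | ⟨z, rfl⟩ := eq_or_exists_skip i z
    · exact self_mem_expand _ _
    · rw [skip_mem_expand]
      have := h.lt
      apply h.linked <;> unfold OmegaParking.skip at h1 h2 <;> split_ifs at h1 h2 <;> omega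

theorem IsRightSpot.skip {i x r : ℤ} {S : Finset ℤ} (h : IsRightSpot S x r) :
    IsRightSpot (expand i S) (skip i x) (skip i r) := by
  refine ⟨by rw [skip_mem_expand]; exact h.notMem, ?_, fun z h1 h2 => ?_⟩
  · rw [← not_le, skip_le_skip, not_le]; exact h.lt
  · obtain rfl | ⟨z, rfl⟩ := eq_or_exists_skip i z
    · exact self_mem_expand _ _
    · rw [skip_mem_expand]
      have := h.lt
      apply h.linked <;> unfold OmegaParking.skip at h1 h2 <;> split_ifs at h1 h2 <;> omega

/-- The preferences of the other cars once the spot of the car `f` is removed. -/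
def contract (v : α → ℤ) (f a : α) : ℤ :=
  if a < f then min (v a) (v f - 1) else max (v a - 1) (v f)

theorem contract_monotone {v : α → ℤ} (hv : Monotone v) (f : α) : Monotone (contract v f) := by
  intro a b hab
  have := hv hab
  unfold contract
  split_ifs with h1 h2
  · omega
  · omega
  · exact absurd (hab.trans_lt ‹b < f›) h1
  · omega

/-- For a car that does not want the spot of f, contraction is pure renumbering. The truncations in
`contract` matter only when the two preferences agree: the car is then sent to the left or right
neighbour according to its comparison with f. -/
theorem eq_skip_contract {v : α → ℤ} (hv : Monotone v) {f a : α} (h : v a ≠ v f) :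
    v a = skip (v f) (contract v f a) := by
  unfold contract skip
  rcases lt_or_ge a f with haf | haf
  · have := hv haf.le
    rw [if_pos haf]
    split_ifs <;> omega
  · have := hv haf
    rw [if_neg haf.not_gt]
    split_ifs <;> omega

theorem linked_skip_contract {v : α → ℤ} (hv : Monotone v) {f a : α} {S : Finset ℤ}
    (h : contract v f a ∈ S) :
    Linked (expand (v f) S) (v a) (skip (v f) (contract v f a)) := by
  by_cases hne : v a = v f
  · intro z h1 h2
    have : z = v f ∨ z = skip (v f) (contract v f a) := by
      unfold contract skip at *
      split_ifs at * <;> omega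
    rcases this with rfl | rfl
    · exact self_mem_expand _ _
    · exact skip_mem_expand.2 h
  · rw [← eq_skip_contract hv hne]
    refine linked_self ?_
    rw [eq_skip_contract hv hne]
    exact skip_mem_expand.2 h

omit [LinearOrder α] in
theorem find?_eq_some_of_exists {p : α → Bool} {l : List α} {b : α} (hb : b ∈ l) (h : p b) :
    ∃ a ∈ l, p a ∧ l.find? p = some a := by
  have := List.find?_isSome.2 ⟨b, hb, h⟩
  obtain ⟨a, ha⟩ := Option.isSome_iff_exists.1 this
  exact ⟨a, List.mem_of_find?_eq_some ha, List.find?_some ha, ha⟩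

/-- The first car can be removed together with its spot. -/
theorem parked_append_singleton {v : α → ℤ} (hv : Monotone v) (f : α) {W : List α} (hf : f ∉ W) :
    parked v (W ++ [f]) = expand (v f) (parked (contract v f) W) := by
  induction W with
  | nil => simp [parked, expand]
  | cons a W ih =>
    rw [List.mem_cons, not_or] at hf
    replace ih := ih hf.2
    have haf : a ≠ f := fun h => hf.1 h.symm
    rw [List.cons_append]
    by_cases h' : contract v f a ∈ parked (contract v f) W
    · have hlink := linked_skip_contract hv h'
      rw [← ih] at hlink
      obtain ⟨b, hbW, hb⟩ := exists_linked_of_mem_parked h'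
      obtain ⟨b, hbW, hb, hfind⟩ := find?_eq_some_of_exists
        (p := fun b => contract v f b ∈ block (parked (contract v f) W) (contract v f a)) hbW
        (by simpa [mem_block_iff] using hb)
      -- The contracted preference is occupied. Linkage is the same before and after contraction, so
      -- both searches stop at the same car of W and never reach f.
      have hfind' : (W ++ [f]).find? (fun b => v b ∈ block (parked v (W ++ [f])) (v a)) = some b := by
        rw [List.find?_append]
        have : W.find? (fun b => v b ∈ block (parked v (W ++ [f])) (v a)) = some b := by
          rw [← hfind]
          refine List.find?_congr fun x hx => ?_
          have hxl := linked_skip_contract hv (apply_mem_parked (v := contract v f) hx)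
          rw [← ih] at hxl
          rw [decide_eq_decide, mem_block_iff, mem_block_iff,
            ← linked_skip (i := v f) (s := contract v f a), ← ih]
          exact ⟨fun h => (hlink.symm.trans h).trans hxl, fun h => (hlink.trans h).trans hxl.symm⟩
        rw [this]
        rfl
      by_cases hab : a < b
      · have hl := isLeftSpot_min' h'
        rw [parked_cons_of_lt hfind hab hl, expand_insert, ← ih]
        refine parked_cons_of_lt hfind' hab ?_
        have := hl.skip (i := v f)
        rw [← ih] at this
        exact this.of_linked hlink.symm
      · have hr := isRightSpot_max' h'
        rw [parked_cons_of_not_lt hfind hab hr, expand_insert, ← ih]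
        refine parked_cons_of_not_lt hfind' hab ?_
        have := hr.skip (i := v f)
        rw [← ih] at this
        exact this.of_linked hlink.symm
    · rw [parked_cons_of_notMem h', expand_insert, ← ih]
      by_cases hne : v a = v f
      -- Here a wants the occupied spot of f, and its contracted spot is the free neighbour of `v f`
      -- on the side given by comparing a with f. The rule compares a with b instead, so b must be
      -- shown to give the same side.
      · have hmem : v f ∈ parked v (W ++ [f]) := apply_mem_parked (by simp)
        obtain ⟨b, hbW, hb, hfind⟩ := find?_eq_some_of_exists
          (p := fun b => v b ∈ block (parked v (W ++ [f])) (v a)) (l := W ++ [f]) (b := f) (by simp)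
          (by simpa [mem_block_iff, hne] using linked_self hmem)
        rw [decide_eq_true_iff, mem_block_iff, hne] at hb
        have hnot : skip (v f) (contract v f a) ∉ parked v (W ++ [f]) := by
          rwa [ih, skip_mem_expand]
        have hW : ∀ x ∈ W, contract v f x ≠ contract v f a := fun x hx h =>
          h' (h ▸ apply_mem_parked hx)
        rcases lt_or_gt_of_ne haf with hlt | hgt
        · have hc : contract v f a = v f - 1 := by simp [contract, hlt, hne]
          have hs : skip (v f) (contract v f a) = v f - 1 := by rw [hc]; simp [skip]
          rw [hs] at hnot ⊢
          refine parked_cons_of_lt hfind ?_ ⟨hnot, by omega, ?_⟩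
          -- If b ≤ a < f, then `v b ≤ v f` by monotonicity, and `v b ≥ v f` because the block of `v
          -- f` cannot pass the free spot `v f - 1`. So b contracts to the same spot as a, which
          -- would then be occupied.
          · by_contra hba
            rw [not_lt] at hba
            have h1 := hv hba
            have h2 : v f ≤ v b := by
              by_contra h2
              exact hnot (hb _ (by omega) (by omega))
            have hbW' : b ∈ W := by
              rcases List.mem_append.1 hbW with h | h
              · exact h
              · rw [List.mem_singleton.1 h] at hba
                exact absurd hba hlt.not_ge
            refine hW b hbW' ?_
            rw [hc, contract, if_pos (hba.trans_lt hlt)]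
            omega
          · rw [sub_add_cancel, hne]; exact linked_self hmem
        · have hc : contract v f a = v f := by simp [contract, hgt.not_gt, hne]
          have hs : skip (v f) (contract v f a) = v f + 1 := by rw [hc]; simp [skip]
          rw [hs] at hnot ⊢
          refine parked_cons_of_not_lt hfind ?_ ⟨hnot, by omega, ?_⟩
          · intro hab
            have h1 := hv hab.le
            have h2 : v b ≤ v f := by
              by_contra h2
              exact hnot (hb _ (by omega) (by omega))
            have hbW' : b ∈ W := by
              rcases List.mem_append.1 hbW with h | h
              · exact h
              · rw [List.mem_singleton.1 h] at hab
                exact absurd hab hgt.not_gt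
            refine hW b hbW' ?_
            rw [hc, contract, if_neg (hgt.trans hab).not_gt]
            omega
          · rw [add_sub_cancel_right, hne]; exact linked_self hmem
      · rw [← eq_skip_contract hv hne]
        refine parked_cons_of_notMem ?_
        rwa [ih, eq_skip_contract hv hne, skip_mem_expand]

theorem expand_eq_Icc_iff {i : ℤ} {S : Finset ℤ} {n : ℕ} :
    expand i S = Finset.Icc 1 ((n + 1 : ℕ) : ℤ) ↔
      (1 ≤ i ∧ i ≤ n + 1) ∧ S = Finset.Icc 1 (n : ℤ) := by
  push_cast
  constructor
  · intro h
    have hi : i ∈ Finset.Icc 1 ((n : ℤ) + 1) := h ▸ self_mem_expand i S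
    rw [Finset.mem_Icc] at hi
    refine ⟨hi, ?_⟩
    ext s
    rw [← skip_mem_expand (i := i), h, Finset.mem_Icc, Finset.mem_Icc]
    unfold skip
    split_ifs <;> omega
  · rintro ⟨hi, rfl⟩
    ext z
    obtain rfl | ⟨s, rfl⟩ := eq_or_exists_skip i z
    · simpa [self_mem_expand] using hi
    · rw [skip_mem_expand, Finset.mem_Icc, Finset.mem_Icc]
      unfold skip
      split_ifs <;> omega

end Parking

/-- Contraction changes preferences but not the order of the cars, so the induction needs
preferences that are not read off the letters. -/
theorem spotsRev_eq_parked (W : List Letter) : spotsRev W = parked Letter.val W := by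
  induction W with
  | nil => rfl
  | cons a W ih =>
    simp only [spotsRev, parked, ih]
    by_cases h : a.val ∈ parked Letter.val W
    · rw [dif_pos h, dif_pos h]
      rcases hb : W.find? (fun b => b.val ∈ block (parked Letter.val W) a.val) with _ | b <;>
        simp only [hb]
    · rw [dif_neg h, dif_neg h]

theorem Letter.val_monotone : Monotone Letter.val := fun _ _ h => Prod.Lex.monotone_fst _ _ h

/-! ### Products of partial sums of the variables -/

/-- The partial sum `x_0 + ⋯ + x_{k-1}` of the variables of `ℚ[x_0, …, x_{n-1}]`. -/
noncomputable def partialSum (n : ℕ) (k : ℤ) : MvPolynomial (Fin n) ℚ :=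
  ∑ j : Fin n, if (j : ℤ) < k then X j else 0

theorem omitVar_partialSum {n : ℕ} (i : Fin (n + 1)) (k : ℤ) :
    omitVar i (partialSum (n + 1) k) = partialSum n (if k ≤ i then k else k - 1) := by
  rw [partialSum, Fin.sum_univ_succAbove _ i, map_add, map_sum]
  rw [show omitVar i (if ((i : ℕ) : ℤ) < k then X i else 0) = 0 by split_ifs <;> simp, zero_add,
    partialSum]
  refine Finset.sum_congr rfl fun j _ => ?_
  have : (((i.succAbove j : Fin (n + 1)) : ℕ) : ℤ) < k ↔ (j : ℤ) < if k ≤ i then k else k - 1 := by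
    simp only [Fin.succAbove, Fin.lt_def, Fin.val_castSucc]
    split_ifs <;> simp only [Fin.val_castSucc, Fin.val_succ] <;> omega
  simp only [this]
  split_ifs <;> simp

theorem partialSum_succ_sub {n : ℕ} (i : Fin n) :
    partialSum n ((i : ℤ) + 1) - partialSum n i = X i := by
  rw [partialSum, partialSum, ← Finset.sum_sub_distrib, Finset.sum_eq_single i]
  · simp
  · intro j _ hj
    have : (j : ℕ) ≠ i := fun h => hj (Fin.ext h)
    have hiff : (j : ℤ) < (i : ℤ) + 1 ↔ (j : ℤ) < i := by omega
    simp only [hiff, sub_self]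
  · simp

/-- Since R_i and R_{i+1} differ by x_i on the factors of value i + 1 and agree on all others,
expanding the difference of products in the order of the letters applies R_i before f and R_{i+1}
after f. On partial sums these two substitutions are the two branches of `contract`. -/
theorem trim_prod_partialSum {α : Type*} [LinearOrder α] {v : α → ℤ} (hv : Monotone v) {n : ℕ}
    (i : Fin n) (S : Finset α) :
    trim i (∏ a ∈ S, partialSum (n + 1) (v a)) = ∑ f ∈ S, if v f = i + 1 then
      ∏ a ∈ S.erase f, partialSum n (contract v f a) else 0 := by
  apply mul_left_cancel₀ (X_ne_zero i : (X i : MvPolynomial (Fin n) ℚ) ≠ 0)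
  -- By `hsub` below, first function minus second function is `omitVar i.castSucc` of the factor.
  have h := Finset.prod_sub_ordered S
    (fun a => omitVar i.succ (partialSum (n + 1) (v a)))
    (fun a => if v a = i + 1 then (X i : MvPolynomial (Fin n) ℚ) else 0)
  have hsub : ∀ a, omitVar i.succ (partialSum (n + 1) (v a)) - (if v a = i + 1 then X i else 0) =
      omitVar i.castSucc (partialSum (n + 1) (v a)) := by
    intro a
    rw [omitVar_partialSum, omitVar_partialSum, Fin.val_succ, Fin.val_castSucc]
    push_cast
    split_ifs with h1 h2 h3 h3
    all_goals first
      | omega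
      | rw [sub_zero]
      | (rw [h2, ← partialSum_succ_sub i]; simp)
  simp only [hsub] at h
  rw [X_mul_trim, map_prod, map_prod, h, sub_sub_cancel, Finset.mul_sum]
  refine Finset.sum_congr rfl fun f hf => ?_
  split_ifs with hvf
  · have hS : S.erase f = S.filter (· < f) ∪ S.filter (f < ·) := by
      ext a
      rw [Finset.mem_erase, Finset.mem_union, Finset.mem_filter, Finset.mem_filter, ← and_or_left,
        ← ne_iff_lt_or_gt, and_comm]
    rw [hS, Finset.prod_union, mul_assoc]
    · congr 2
      · refine Finset.prod_congr rfl fun a ha => ?_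
        rw [Finset.mem_filter] at ha
        have := hv ha.2.le
        rw [omitVar_partialSum, Fin.val_castSucc, contract, if_pos ha.2]
        congr 1
        split_ifs <;> omega
      · refine Finset.prod_congr rfl fun a ha => ?_
        rw [Finset.mem_filter] at ha
        have := hv ha.2.le
        rw [omitVar_partialSum, Fin.val_succ, contract, if_neg ha.2.not_gt]
        congr 1
        push_cast
        split_ifs <;> omega
    · rw [Finset.disjoint_filter]
      exact fun a _ h => h.not_gt
  · simp

/-! ### Counting parking orders by their first car -/

/-- The orders in which the cars of `S` occupy exactly the spots `1, …, n`. -/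
noncomputable def parkingOrders {α : Type*} [LinearOrder α] (v : α → ℤ) (n : ℕ) (S : Finset α) :
    Finset (List α) :=
  {W ∈ S.toList.permutations.toFinset | parked v W.reverse = Finset.Icc 1 (n : ℤ)}

theorem mem_permutations_toList_iff {α : Type*} [DecidableEq α] {S : Finset α} {W : List α} :
    W ∈ S.toList.permutations.toFinset ↔ W.Nodup ∧ W.toFinset = S := by
  rw [List.mem_toFinset, List.mem_permutations]
  constructor
  · intro h
    exact ⟨h.nodup_iff.2 S.nodup_toList, by rw [List.toFinset_eq_of_perm _ _ h, Finset.toList_toFinset]⟩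
  · rintro ⟨h, rfl⟩
    exact List.perm_of_nodup_nodup_toFinset_eq h (Finset.nodup_toList _)
      (Finset.toList_toFinset _).symm

theorem mem_parkingOrders {α : Type*} [LinearOrder α] {v : α → ℤ} {n : ℕ} {S : Finset α}
    {W : List α} : W ∈ parkingOrders v n S ↔
      (W.Nodup ∧ W.toFinset = S) ∧ parked v W.reverse = Finset.Icc 1 (n : ℤ) := by
  rw [parkingOrders, Finset.mem_filter, mem_permutations_toList_iff]

/-- Reversal puts the first car at the end of the list, where `parked_append_singleton` removes it.
-/
theorem parkingOrders_succ {α : Type*} [LinearOrder α] {v : α → ℤ} (hv : Monotone v) (n : ℕ)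
    (S : Finset α) : parkingOrders v (n + 1) S =
      {f ∈ S | 1 ≤ v f ∧ v f ≤ n + 1}.biUnion fun f =>
        (parkingOrders (contract v f) n (S.erase f)).image (List.cons f) := by
  have key : ∀ f W, f ∉ W → (parked v (f :: W).reverse = Finset.Icc 1 ((n + 1 : ℕ) : ℤ) ↔
      (1 ≤ v f ∧ v f ≤ n + 1) ∧ parked (contract v f) W.reverse = Finset.Icc 1 (n : ℤ)) := by
    intro f W hf
    rw [List.reverse_cons, parked_append_singleton hv f (by simpa using hf), expand_eq_Icc_iff]
  ext W
  simp only [Finset.mem_biUnion, Finset.mem_image, Finset.mem_filter, mem_parkingOrders]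
  constructor
  · rintro ⟨⟨hW, rfl⟩, hp⟩
    obtain _ | ⟨f, W⟩ := W
    · have : (1 : ℤ) ∈ Finset.Icc 1 ((n + 1 : ℕ) : ℤ) := by simp
      rw [← hp] at this
      simp [parked] at this
    · rw [List.nodup_cons] at hW
      rw [key f W hW.1] at hp
      exact ⟨f, ⟨by simp, hp.1⟩, W, ⟨⟨hW.2, by simp [hW.1]⟩, hp.2⟩, rfl⟩
  · rintro ⟨f, ⟨hf, hvf⟩, W, ⟨⟨hW, hS⟩, hp⟩, rfl⟩
    have hfW : f ∉ W := by
      rw [← List.mem_toFinset, hS]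
      simp
    exact ⟨⟨List.nodup_cons.2 ⟨hfW, hW⟩, by rw [List.toFinset_cons, hS, Finset.insert_erase hf]⟩,
      (key f W hfW).2 ⟨hvf, hp⟩⟩

theorem card_parkingOrders_succ {α : Type*} [LinearOrder α] {v : α → ℤ} (hv : Monotone v) (n : ℕ)
    (S : Finset α) : (parkingOrders v (n + 1) S).card =
      ∑ f ∈ S with 1 ≤ v f ∧ v f ≤ n + 1, (parkingOrders (contract v f) n (S.erase f)).card := by
  rw [parkingOrders_succ hv, Finset.card_biUnion]
  · exact Finset.sum_congr rfl fun f _ => Finset.card_image_of_injective _ List.cons_injective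
  · intro f _ g _ hfg
    rw [Function.onFun, Finset.disjoint_left]
    intro W hf hg
    obtain ⟨_, _, rfl⟩ := Finset.mem_image.1 hf
    obtain ⟨_, _, h⟩ := Finset.mem_image.1 hg
    exact hfg (List.cons.inj h).1.symm

theorem trimSum_prod_partialSum {α : Type*} [LinearOrder α] {v : α → ℤ} (hv : Monotone v) {n : ℕ}
    {S : Finset α} (hS : S.card = n) :
    trimSum n (∏ a ∈ S, partialSum (n + 1) (v a)) = (parkingOrders v n S).card := by
  induction n generalizing v S with
  | zero =>
    obtain rfl := Finset.card_eq_zero.1 hS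
    have : parkingOrders v 0 ∅ = {[]} := by
      ext W
      simp only [mem_parkingOrders, List.toFinset_eq_empty_iff, Finset.mem_singleton]
      refine ⟨fun h => h.1.2, ?_⟩
      rintro rfl
      simp [parked]
    rw [this]
    simp
  | succ n ih =>
    rw [trimSum_succ, Finset.sum_congr rfl fun i _ => trim_prod_partialSum hv i S,
      Finset.sum_comm, map_sum, card_parkingOrders_succ hv, Finset.sum_filter, Nat.cast_sum]
    refine Finset.sum_congr rfl fun f hf => ?_
    split_ifs with h
    -- The variables are indexed from 0 and the spots from 1, so the only operator that removes f
    -- has index `v f - 1`.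
    · rw [Finset.sum_eq_single (⟨(v f - 1).toNat, by omega⟩ : Fin (n + 1))]
      · rw [if_pos (by simp; omega), ih (contract_monotone hv f)]
        rw [Finset.card_erase_of_mem hf, hS, Nat.add_sub_cancel]
      · intro i _ hi
        rw [if_neg]
        intro h'
        exact hi (Fin.ext (by simp; omega))
      · simp
    · rw [Finset.sum_eq_zero]
      · simp
      · intro i _
        rw [if_neg]
        have := i.isLt
        omega

/-! ### The alphabet, and y_c as a product over its letters -/

/-- The finite set of letters of `alphabet c`. -/
def letters {m : ℕ} (c : Fin m → ℕ) : Finset Letter :=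
  (Finset.univ : Finset (Σ i : Fin m, Fin (c i))).map
    ⟨fun p => toLex ((p.1 : ℤ) + 1, Nat.succPNat p.2), by
      rintro ⟨i, j⟩ ⟨i', j'⟩ h
      rw [toLex_inj, Prod.mk.injEq, add_left_inj, Nat.cast_inj, Fin.val_inj] at h
      obtain ⟨h1, h2⟩ := h
      dsimp only at h1 h2
      subst h1
      rw [Nat.succPNat_inj, Fin.val_inj] at h2
      rw [h2]⟩

theorem mem_letters {m : ℕ} {c : Fin m → ℕ} {a : Letter} : a ∈ letters c ↔ a ∈ alphabet c := by
  simp only [letters, Finset.mem_map, Finset.mem_univ, true_and, alphabet, Set.mem_ofPred_eq]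
  constructor
  · rintro ⟨⟨i, j⟩, rfl⟩
    exact ⟨i, rfl, j.isLt⟩
  · rintro ⟨i, hi, hj⟩
    have hpos := a.sup.pos
    refine ⟨⟨i, ⟨a.sup - 1, by omega⟩⟩, ?_⟩
    refine toLex.symm.injective (Prod.ext hi.symm (PNat.eq ?_))
    exact Nat.sub_add_cancel hpos

theorem card_letters {m : ℕ} (c : Fin m → ℕ) : (letters c).card = ∑ i, c i := by
  simp [letters]

theorem yPoly_eq_prod {m : ℕ} (c : Fin m → ℕ) :
    yPoly c = ∏ a ∈ letters c, partialSum (m + 1) a.val := by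
  rw [letters, Finset.prod_map, Fintype.prod_sigma, yPoly]
  refine Finset.prod_congr rfl fun i _ => ?_
  change _ = ∏ _j : Fin (c i), partialSum (m + 1) ((i : ℤ) + 1)
  rw [Finset.prod_const, Finset.card_univ, Fintype.card_fin]
  congr 1
  rw [partialSum, Fin.sum_univ_castSucc, if_neg (by simp), add_zero, ← Finset.sum_filter]
  refine Finset.sum_congr ?_ fun _ _ => rfl
  ext j
  simp only [Finset.mem_Iic, Finset.mem_filter, Finset.mem_univ, true_and, Fin.val_castSucc,
    Fin.le_def]
  omega

theorem mem_injectiveWords_iff {m : ℕ} {c : Fin m → ℕ} (hc : ∑ i, c i = m) {W : List Letter} :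
    W ∈ injectiveWords c ↔ W.Nodup ∧ W.toFinset = letters c := by
  constructor
  · rintro ⟨h, hm, hW⟩
    refine ⟨h, Finset.eq_of_subset_of_card_le (fun a ha => ?_) ?_⟩
    · exact mem_letters.2 (hW a (List.mem_toFinset.1 ha))
    · rw [card_letters, hc, List.toFinset_card_of_nodup h, hm]
  · rintro ⟨h, hW⟩
    refine ⟨h, ?_, fun a ha => ?_⟩
    · rw [← List.toFinset_card_of_nodup h, hW, card_letters, hc]
    · rwa [← mem_letters, ← hW, List.mem_toFinset]

theorem ncard_injectiveWords {m : ℕ} {c : Fin m → ℕ} (hc : ∑ i, c i = m) :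
    (injectiveWords c).ncard = m.factorial := by
  have : injectiveWords c = ((letters c).toList.permutations.toFinset : Set (List Letter)) := by
    ext W
    rw [mem_injectiveWords_iff hc, Finset.mem_coe, mem_permutations_toList_iff]
  rw [this, Set.ncard_coe_finset, List.toFinset_card_of_nodup
    (List.nodup_permutations _ (Finset.nodup_toList _)), List.length_permutations,
    Finset.length_toList, card_letters, hc]

theorem isHomogeneous_yPoly {m : ℕ} {c : Fin m → ℕ} (hc : ∑ i, c i = m) :
    (yPoly c).IsHomogeneous m := by
  have h : (yPoly c).IsHomogeneous (∑ i, c i) := by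
    refine IsHomogeneous.prod _ _ _ fun i _ => ?_
    simpa using (IsHomogeneous.sum (Finset.Iic i) _ 1 fun j _ =>
      isHomogeneous_X ℚ (Fin.castSucc j)).pow (c i)
  rwa [hc] at h

theorem isABBReduction_abbReduction {n : ℕ} (f : MvPolynomial (Fin n) ℚ) :
    IsABBReduction f (abbReduction f) := by
  have h := exists_isABBReduction f
  rw [abbReduction, dif_pos h]
  exact h.choose_spec

theorem eval_mixedEulerian {m : ℕ} {c : Fin m → ℕ} (hc : ∑ i, c i = m) :
    eval (fun _ => (1 : ℚ)) (mixedEulerian c) = (parkingOrders Letter.val m (letters c)).card := by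
  have h := isABBReduction_abbReduction (yPoly c)
  rw [mixedEulerian, ← trimSum_eq_eval h.1 (h.isHomogeneous (isHomogeneous_yPoly hc)),
    ← trimSum_prod_partialSum Letter.val_monotone ((card_letters c).trans hc), ← yPoly_eq_prod,
    eq_comm, ← sub_eq_zero, ← map_sub, trimSum_eq_zero h.2]

end OmegaParking

theorem mainTheorem9 (m : ℕ) (c : Fin m → ℕ) (hc : ∑ i, c i = m) :
    (∃! r, OmegaParking.IsABBReduction (OmegaParking.yPoly c) r) ∧
    (OmegaParking.injectiveWords c).ncard = m.factorial ∧
    MvPolynomial.eval (fun _ => (1 : ℚ)) (OmegaParking.mixedEulerian c) =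
      ({W | W ∈ OmegaParking.injectiveWords c ∧ OmegaParking.IsParkingWord W}.ncard : ℚ) := by
  refine ⟨OmegaParking.existsUnique_isABBReduction _, OmegaParking.ncard_injectiveWords hc, ?_⟩
  rw [OmegaParking.eval_mixedEulerian hc, ← Set.ncard_coe_finset]
  congr 2
  ext W
  rw [Finset.mem_coe, OmegaParking.mem_parkingOrders, Set.mem_ofPred_eq,
    OmegaParking.mem_injectiveWords_iff hc, OmegaParking.IsParkingWord, OmegaParking.spots,
    OmegaParking.spotsRev_eq_parked]
  refine and_congr_right fun h => ?_
  rw [← List.toFinset_card_of_nodup h.1, h.2, OmegaParking.card_letters, hc]
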